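/- **Semantic substitution lemma for $\lambda_{[\tau]}$.** *Calculus.* Fix base types $\mathsf b$, constants $\mathsf f:(A_1,\dots,A_n)\to B$ and operations $\mathsf{op}: A_{\mathsf{op}}\leadsto B_{\mathsf{op}}\,!\,\tau_{\mathsf{op}}$ with $\tau_{\mathsf{op}}\in\mathbb N$, where the $A$'s and $B$'s are ground types $A::=\mathsf b\mid\mathsf{unit}\mid A\times B\mid[\tau]A$. Value types are $X::=A\mid X\times Y\mid X\to Y!\tau\mid[\tau]X$, and contexts are $\Gamma::=\cdot\mid\Gamma,x{:}X\mid\Gamma,\langle\tau\rangle$. The time of a context is the sum of its modalities $\langle\tau\rangle$. The earlier context $\Gamma-\tau$ is given by $\Gamma-0=\Gamma$ and, for $\tau>0$, by $\cdot-\tau=\cdot$, $(\Gamma,x{:}X)-\tau=\Gamma-\tau$, and $(\Gamma,\langle\tau'\rangle)-\tau$ is $\Gamma,\langle\tau'-\tau\rangle$ if $\tau\le\tau'$ and $\Gamma-(\tau-\tau')$ otherwise. Terms are considered up to renaming of bound variables. The typing rules are: - $\Gamma,x{:}X,\Gamma'\vdash x:X$; $\ \Gamma\vdash\mathsf f(V_1,\dots,V_n):B$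 if $\Gamma\vdash V_i:A_i$ for all $i$; $\ \Gamma\vdash():\mathsf{unit}$; $\ \Gamma\vdash(V,W):X\times Y$ if $\Gamma\vdash V:X$ and $\Gamma\vdash W:Y$; $\ \Gamma\vdash\mathsf{fun}\,(x{:}X)\mapsto M:X\to Y!\tau$ if $\Gamma,x{:}X\vdash M:Y!\tau$; $\ \Gamma\vdash\mathsf{box}_\tau V:[\tau]X$ if $\Gamma,\langle\tau\rangle\vdash V:X$; - $\Gamma\vdash\mathsf{return}\,V:X!0$ if $\Gamma\vdash V:X$; $\ \Gamma\vdash\mathsf{let}\,x=M\,\mathsf{in}\,N:Y!(\tau+\tau')$ if $\Gamma\vdash M:X!\tau$ and $\Gamma,\langle\tau\rangle,x{:}X\vdash N:Y!\tau'$; $\ \Gamma\vdash V\,W:Y!\tau$ if $\Gamma\vdash V:X\to Y!\tau$ and $\Gamma\vdash W:X$; $\ \Gamma\vdash\mathsf{match}\,V\,\mathsf{with}\,(x,y)\mapsto N:Z!\tau$ if $\Gamma\vdash V:X\times Y$ and $\Gamma,x{:}X,y{:}Y\vdash N:Z!\tau$; - $\Gamma\vdash\mathsf{op}\,V\,(x.M):X!(\tau_{\mathsf{op}}+\tau)$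 if $\Gamma\vdash V:A_{\mathsf{op}}$ and $\Gamma,\langle\tau_{\mathsf{op}}\rangle,x{:}B_{\mathsf{op}}\vdash M:X!\tau$; $\ \Gamma\vdash\mathsf{delay}\,\tau\,M:X!(\tau+\tau')$ if $\Gamma,\langle\tau\rangle\vdash M:X!\tau'$; - $\Gamma\vdash\mathsf{handle}\,M\,\mathsf{with}\,(x.k.M_{\mathsf{op}})_{\mathsf{op}}\,\mathsf{to}\,x\,\mathsf{in}\,N:Y!(\tau+\tau')$ if $\Gamma\vdash M:X!\tau$, $\ \Gamma,\langle\tau\rangle,x{:}X\vdash N:Y!\tau'$ and, for every operation $\mathsf{op}$ and every $\tau''\in\mathbb N$, $\ \Gamma,x{:}A_{\mathsf{op}},k{:}[\tau_{\mathsf{op}}](B_{\mathsf{op}}\to Y!\tau'')\vdash M_{\mathsf{op}}:Y!(\tau_{\mathsf{op}}+\tau'')$; - $\Gamma\vdash\mathsf{unbox}_\tau\,V\,\mathsf{as}\,x\,\mathsf{in}\,N:Y!\tau'$ if $\tau\le\mathsf{time}\,\Gamma$, $\ \Gamma-\tau\vdash V:[\tau]X$ and $\Gamma,x{:}X\vdash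 N:Y!\tau'$. *Models.* A model is a category $\mathbb C$ with finite products, exponentials and set-indexed products, together with: strong monoidal functors $[-]:(\mathbb N,\le)\to[\mathbb C,\mathbb C]$ (with natural isomorphisms $\varepsilon:[0]A\cong A$ and $\delta:[\tau_1+\tau_2]A\cong[\tau_1][\tau_2]A$) and $\langle-\rangle:(\mathbb N,\le)^{\mathrm{op}}\to[\mathbb C,\mathbb C]$ (with $\eta:A\cong\langle0\rangle A$ and $\mu:\langle\tau_1\rangle\langle\tau_2\rangle A\cong\langle\tau_1+\tau_2\rangle A$), satisfying the graded (co)monad laws and monotonicity of $\delta,\mu$ in the grades; adjunctions $\langle\tau\rangle\dashv[\tau]$ compatible with these structures; an $\mathbb N$-graded monad $(T,\eta^T,\mu^T)$ with a natural strength $\mathsf{str}:[\tau]A\times T\tau B\to T\tau(A\times B)$ satisfying the strength laws; objects $[\![\mathsf b]\!]$ and morphisms $[\![\mathsf f]\!]:\prod_i[\![A_i]\!]\to[\![B]\!]$; natural families $\mathsf{op}^T:[\![A_{\mathsf{op}}]\!]\times[\tau_{\mathsf{op}}]([\![B_{\mathsf{op}}]\!]\Rightarrow T\tau A)\to T(\tau_{\mathsf{op}}+\tau)A$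 and $\mathsf{delay}^T:[\tau](T\tau'A)\to T(\tau+\tau')A$ that commute with $\mu^T$ and $\mathsf{str}$; and handling morphisms $\chi_{A,\tau,\tau'}:\prod_{\mathsf{op}}\prod_{\tau''}\big(([\![A_{\mathsf{op}}]\!]\times[\tau_{\mathsf{op}}]([\![B_{\mathsf{op}}]\!]\Rightarrow T\tau''A))\Rightarrow T(\tau_{\mathsf{op}}+\tau'')A\big)\to(T\tau(T\tau'A)\Rightarrow T(\tau+\tau')A)$ compatible with $\eta^T$, $\mathsf{op}^T$ and $\mathsf{delay}^T$. *Interpretation.* Types are interpreted by $[\![\mathsf{unit}]\!]=\mathbb 1$, $[\![X\times Y]\!]=[\![X]\!]\times[\![Y]\!]$, $[\![X\to Y!\tau]\!]=[\![X]\!]\Rightarrow T\tau[\![Y]\!]$, $[\![[\tau]X]\!]=[\tau][\![X]\!]$, and contexts as functors by $[\![\cdot]\!]A=A$, $[\![\Gamma,x{:}X]\!]A=[\![\Gamma]\!]A\times[\![X]\!]$, $[\![\Gamma,\langle\tau\rangle]\!]A=\langle\tau\rangle([\![\Gamma]\!]A)$. Let $\iota_{\Gamma;\Gamma';A}:[\![\Gamma,\Gamma']\!]A\cong[\![\Gamma']\!]([\![\Gamma]\!]A)$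 be the canonical isomorphism. Derivations of $\Gamma\vdash V:X$ and of $\Gamma\vdash M:X!\tau$ are interpreted, by recursion, as morphisms $[\![V]\!]:[\![\Gamma]\!]\mathbb 1\to[\![X]\!]$ and $[\![M]\!]:[\![\Gamma]\!]\mathbb 1\to T\tau[\![X]\!]$ in the standard way: a variable $x$ in $\Gamma,x{:}X,\Gamma'$ denotes $\iota$ followed by the map $[\![\Gamma']\!](-)\to\langle\mathsf{time}\,\Gamma'\rangle(-)\to\mathrm{Id}$ that collapses and discards all modalities of $\Gamma'$, and the second projection; the unit of $\langle\tau\rangle\dashv[\tau]$ interprets $\mathsf{box}$ and moves the environment under the modality in $\mathsf{let}$, $\mathsf{op}$, $\mathsf{delay}$ and $\mathsf{handle}$; $\mathsf{let}$ is strength followed by $\mu^T$; operations, delays and handlers use $\mathsf{op}^T$, $\mathsf{delay}^T$, $\chi$; and $\mathsf{unbox}_\tau$ uses the canonical map $[\![\Gamma]\!]\mathbb 1\to\langle\tau\rangle([\![\Gamma-\tau]\!]\mathbb 1)$ and the counit of the adjunction. *Proposition.* Let $J$ be a value or a computation. If $\Gamma,x{:}X,\Gamma'\vdash J$ (meaning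 $\Gamma,x{:}X,\Gamma'\vdash V:Y$ or $\Gamma,x{:}X,\Gamma'\vdash M:Y!\tau$) and $\Gamma\vdash W:X$, then $\Gamma,\Gamma'\vdash J[W/x]$ is derivable at the same type (and grade), where $J[W/x]$ is capture-avoiding substitution, and every derivation of it satisfies $$[\![J[W/x]]\!]=[\![J]\!]\circ\iota^{-1}_{\Gamma,x:X;\Gamma';\mathbb 1}\circ[\![\Gamma']\!]\big(\langle\mathrm{id},[\![W]\!]\rangle\big)\circ\iota_{\Gamma;\Gamma';\mathbb 1}.$$ -/

import Mathlib

open CategoryTheory CategoryTheory.Limits CategoryTheory.MonoidalCategory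
open CategoryTheory.CartesianMonoidalCategory Opposite

universe u v w

namespace LambdaTau

/-! # Syntax of the calculus -/

/-- Ground types `A, B ::= b | unit | A × B | [τ] A` over a set of base types. -/
inductive GTy (Base : Type u) : Type u
  | base (b : Base)
  | unit
  | prod (A B : GTy Base)
  | box (τ : ℕ) (A : GTy Base)

/-- Value types: ground types closed under products, function types `X → Y ! τ`
and temporal resource types `[τ] X`. -/
inductive VTy (Base : Type u) : Type u
  | base (b : Base)
  | unit
  | prod (X Y : VTy Base)
  | fn (X Y : VTy Base) (τ : ℕ)
  | box (τ : ℕ) (X : VTy Base)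

/-- The inclusion of ground types into value types. -/
def GTy.toVTy {Base : Type u} : GTy Base → VTy Base
  | .base b => .base b
  | .unit => .unit
  | .prod A B => .prod A.toVTy B.toVTy
  | .box τ A => .box τ A.toVTy

/-- The parameters of the calculus: base types, constants `f : (A₁, …, Aₙ) → B`, and
operations `op : A_op ⇝ B_op ! τ_op`. -/
structure Signature where
  Base : Type u
  Cst : Type u
  arity : Cst → ℕ
  cstDom : (f : Cst) → Fin (arity f) → GTy Base
  cstCod : Cst → GTy Base
  Op : Type u
  opArg : Op → GTy Base
  opRes : Op → GTy Base
  opTime : Op → ℕ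

/- Raw terms, with variables as de Bruijn indices (index `0` is the rightmost variable of the
context; context modalities are not counted). -/
mutual
/-- Raw values. -/
inductive Val (S : Signature.{u}) : Type u
  | var (n : ℕ)
  | const (f : S.Cst) (Vs : Fin (S.arity f) → Val S)
  | unit
  | pair (V W : Val S)
  /-- `fun (x : X) ↦ M`, binding one variable in `M`. -/
  | fn (X : VTy S.Base) (M : Cmp S)
  | box (τ : ℕ) (V : Val S)
/-- Raw computations. -/
inductive Cmp (S : Signature.{u}) : Type u
  | ret (V : Val S)
  /-- `let x = M in N`, binding one variable in `N`. -/
  | letIn (M N : Cmp S)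
  | app (V W : Val S)
  /-- `match V with (x, y) ↦ N`, binding `x` (index `1`) and `y` (index `0`) in `N`. -/
  | matchPair (V : Val S) (N : Cmp S)
  /-- `op V (x. M)`, binding one variable in `M`. -/
  | op (o : S.Op) (V : Val S) (M : Cmp S)
  | delay (τ : ℕ) (M : Cmp S)
  /-- `handle M with H to x in N`, where each clause `H op = (x. k. M_op)` binds `x` (index `1`)
  and `k` (index `0`), and `N` has one bound variable. -/
  | handle (M : Cmp S) (H : S.Op → Cmp S) (N : Cmp S)
  /-- `unbox_τ V as x in N`, binding one variable in `N`. -/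
  | unbox (τ : ℕ) (V : Val S) (N : Cmp S)
end

/- Weakening: `J.shift k c` renames every free variable `n ≥ c` of `J` to `n + k`. -/
mutual
def Val.shift {S : Signature.{u}} : Val S → ℕ → ℕ → Val S
  | .var n, k, c => .var (if n < c then n else n + k)
  | .const f Vs, k, c => .const f fun i => (Vs i).shift k c
  | .unit, _, _ => .unit
  | .pair V W, k, c => .pair (V.shift k c) (W.shift k c)
  | .fn X M, k, c => .fn X (M.shift k (c + 1))
  | .box τ V, k, c => .box τ (V.shift k c)
def Cmp.shift {S : Signature.{u}} : Cmp S → ℕ → ℕ → Cmp S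
  | .ret V, k, c => .ret (V.shift k c)
  | .letIn M N, k, c => .letIn (M.shift k c) (N.shift k (c + 1))
  | .app V W, k, c => .app (V.shift k c) (W.shift k c)
  | .matchPair V N, k, c => .matchPair (V.shift k c) (N.shift k (c + 2))
  | .op o V M, k, c => .op o (V.shift k c) (M.shift k (c + 1))
  | .delay τ M, k, c => .delay τ (M.shift k c)
  | .handle M H N, k, c =>
      .handle (M.shift k c) (fun o => (H o).shift k (c + 2)) (N.shift k (c + 1))
  | .unbox τ V N, k, c => .unbox τ (V.shift k c) (N.shift k (c + 1))
end

/- Capture-avoiding substitution: `J.subst W j` is `J[W/x]`, where `x` is the variable with index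
`j` in the context `Γ, x : X, Γ'` of `J` (so `Γ'` has `j` variables), and `W` is a value in
context `Γ`. The variables of `Γ` that occur in `J` move down by one, and `W` is weakened by the
`j` variables of `Γ'` where it is plugged in. -/
mutual
def Val.subst {S : Signature.{u}} : Val S → Val S → ℕ → Val S
  | .var n, W, j => if n < j then .var n else if n = j then W.shift j 0 else .var (n - 1)
  | .const f Vs, W, j => .const f fun i => (Vs i).subst W j
  | .unit, _, _ => .unit
  | .pair V V', W, j => .pair (V.subst W j) (V'.subst W j)
  | .fn X M, W, j => .fn X (M.subst W (j + 1))
  | .box τ V, W, j => .box τ (V.subst W j)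
def Cmp.subst {S : Signature.{u}} : Cmp S → Val S → ℕ → Cmp S
  | .ret V, W, j => .ret (V.subst W j)
  | .letIn M N, W, j => .letIn (M.subst W j) (N.subst W (j + 1))
  | .app V V', W, j => .app (V.subst W j) (V'.subst W j)
  | .matchPair V N, W, j => .matchPair (V.subst W j) (N.subst W (j + 2))
  | .op o V M, W, j => .op o (V.subst W j) (M.subst W (j + 1))
  | .delay τ M, W, j => .delay τ (M.subst W j)
  | .handle M H N, W, j =>
      .handle (M.subst W j) (fun o => (H o).subst W (j + 2)) (N.subst W (j + 1))
  | .unbox τ V N, W, j => .unbox τ (V.subst W j) (N.subst W (j + 1))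
end

/-! # Contexts and typing -/

/-- Temporal typing contexts `Γ ::= · | Γ, x : X | Γ, ⟨τ⟩`. -/
inductive Ctx (Base : Type u) : Type u
  | nil
  | var (Γ : Ctx Base) (X : VTy Base)
  | mod (Γ : Ctx Base) (τ : ℕ)

namespace Ctx

variable {Base : Type u}

/-- Concatenation `Γ, Γ'`. -/
def append (Γ : Ctx Base) : Ctx Base → Ctx Base
  | nil => Γ
  | var Γ' X => var (append Γ Γ') X
  | mod Γ' τ => mod (append Γ Γ') τ

/-- The number of variables of a context. -/
def len : Ctx Base → ℕ
  | nil => 0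
  | var Γ _ => len Γ + 1
  | mod Γ _ => len Γ

/-- The time captured by a context. -/
def time : Ctx Base → ℕ
  | nil => 0
  | var Γ _ => time Γ
  | mod Γ τ => time Γ + τ

/-- The earlier context `Γ - τ`. -/
def minus : Ctx Base → ℕ → Ctx Base
  | Γ, 0 => Γ
  | nil, _ + 1 => nil
  | var Γ _, t + 1 => minus Γ (t + 1)
  | mod Γ τ', t + 1 => if t + 1 ≤ τ' then mod Γ (τ' - (t + 1)) else minus Γ (t + 1 - τ')

theorem minus_mod_of_le (Γ : Ctx Base) {t τ' : ℕ} (h : t + 1 ≤ τ') :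
    (mod Γ τ').minus (t + 1) = mod Γ (τ' - (t + 1)) := by
  simp [minus, h]

theorem minus_mod_of_not_le (Γ : Ctx Base) {t τ' : ℕ} (h : ¬ t + 1 ≤ τ') :
    (mod Γ τ').minus (t + 1) = Γ.minus (t + 1 - τ') := by
  simp [minus, h]

end Ctx

/- Typing derivations for `Γ ⊢ V : X` and `Γ ⊢ M : X ! τ`. -/
mutual
/-- Derivations of `Γ ⊢ V : X`. -/
inductive VTyping (S : Signature.{u}) : Ctx S.Base → Val S → VTy S.Base → Type u
  /-- `Γ, x : X, Γ' ⊢ x : X`; the index of `x` is the number of variables of `Γ'`. -/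
  | var {Δ : Ctx S.Base} {n : ℕ} {X : VTy S.Base} (Γ Γ' : Ctx S.Base)
      (hΔ : Δ = (Γ.var X).append Γ') (hn : n = Γ'.len) :
      VTyping S Δ (.var n) X
  | const {Γ : Ctx S.Base} (f : S.Cst) {Vs : Fin (S.arity f) → Val S}
      (dVs : (i : Fin (S.arity f)) → VTyping S Γ (Vs i) (S.cstDom f i).toVTy) :
      VTyping S Γ (.const f Vs) (S.cstCod f).toVTy
  | unit {Γ : Ctx S.Base} : VTyping S Γ .unit .unit
  | pair {Γ : Ctx S.Base} {V W : Val S} {X Y : VTy S.Base}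
      (dV : VTyping S Γ V X) (dW : VTyping S Γ W Y) :
      VTyping S Γ (.pair V W) (.prod X Y)
  | fn {Γ : Ctx S.Base} {M : Cmp S} {X Y : VTy S.Base} {τ : ℕ}
      (dM : CTyping S (Γ.var X) M Y τ) :
      VTyping S Γ (.fn X M) (.fn X Y τ)
  | box {Γ : Ctx S.Base} {V : Val S} {X : VTy S.Base} {τ : ℕ}
      (dV : VTyping S (Γ.mod τ) V X) :
      VTyping S Γ (.box τ V) (.box τ X)
/-- Derivations of `Γ ⊢ M : X ! τ`. -/
inductive CTyping (S : Signature.{u}) : Ctx S.Base → Cmp S → VTy S.Base → ℕ → Type u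
  | ret {Γ : Ctx S.Base} {V : Val S} {X : VTy S.Base} (dV : VTyping S Γ V X) :
      CTyping S Γ (.ret V) X 0
  | letIn {Γ : Ctx S.Base} {M N : Cmp S} {X Y : VTy S.Base} {τ τ' : ℕ}
      (dM : CTyping S Γ M X τ) (dN : CTyping S ((Γ.mod τ).var X) N Y τ') :
      CTyping S Γ (.letIn M N) Y (τ + τ')
  | app {Γ : Ctx S.Base} {V W : Val S} {X Y : VTy S.Base} {τ : ℕ}
      (dV : VTyping S Γ V (.fn X Y τ)) (dW : VTyping S Γ W X) :
      CTyping S Γ (.app V W) Y τ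
  | matchPair {Γ : Ctx S.Base} {V : Val S} {N : Cmp S} {X Y Z : VTy S.Base} {τ : ℕ}
      (dV : VTyping S Γ V (.prod X Y)) (dN : CTyping S ((Γ.var X).var Y) N Z τ) :
      CTyping S Γ (.matchPair V N) Z τ
  | op {Γ : Ctx S.Base} (o : S.Op) {V : Val S} {M : Cmp S} {X : VTy S.Base} {τ : ℕ}
      (dV : VTyping S Γ V (S.opArg o).toVTy)
      (dM : CTyping S ((Γ.mod (S.opTime o)).var (S.opRes o).toVTy) M X τ) :
      CTyping S Γ (.op o V M) X (S.opTime o + τ)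
  | delay {Γ : Ctx S.Base} {M : Cmp S} {X : VTy S.Base} {τ τ' : ℕ}
      (dM : CTyping S (Γ.mod τ) M X τ') :
      CTyping S Γ (.delay τ M) X (τ + τ')
  | handle {Γ : Ctx S.Base} {M N : Cmp S} {H : S.Op → Cmp S} {X Y : VTy S.Base} {τ τ' : ℕ}
      (dM : CTyping S Γ M X τ)
      (dN : CTyping S ((Γ.mod τ).var X) N Y τ')
      (dH : (o : S.Op) → (τ'' : ℕ) →
        CTyping S ((Γ.var (S.opArg o).toVTy).var
            (.box (S.opTime o) (.fn (S.opRes o).toVTy Y τ'')))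
          (H o) Y (S.opTime o + τ'')) :
      CTyping S Γ (.handle M H N) Y (τ + τ')
  /-- The value being unboxed is a term `V` of the earlier context `Γ - τ`. As `Γ` has
  `Γ.len - (Γ.minus τ).len` further variables on the right, the variables of `V` have
  correspondingly larger indices when `V` is regarded as a subterm of a term of `Γ`. -/
  | unbox {Γ : Ctx S.Base} {V V' : Val S} {N : Cmp S} {X Y : VTy S.Base} {τ τ' : ℕ}
      (hτ : τ ≤ Γ.time)
      (hV : V' = V.shift (Γ.len - (Γ.minus τ).len) 0)
      (dV : VTyping S (Γ.minus τ) V (.box τ X))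
      (dN : CTyping S (Γ.var X) N Y τ') :
      CTyping S Γ (.unbox τ V' N) Y τ'
end

/-! # Models -/

section Exponentials

variable {C : Type v} [Category.{w} C] [CartesianMonoidalCategory C] [MonoidalClosed C]

/-- Currying of the right-hand factor, for the exponential `A ⇒ B := (ihom A).obj B`. -/
def curr {P A B : C} (f : P ⊗ A ⟶ B) : P ⟶ (ihom A).obj B :=
  MonoidalClosed.curry (lift (snd A P) (fst A P) ≫ f)

/-- Uncurrying: `uncurr g` is `P ⊗ A ⟶ (A ⇒ B) ⊗ A ⟶ B`. -/
def uncurr {P A B : C} (g : P ⟶ (ihom A).obj B) : P ⊗ A ⟶ B :=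
  lift (snd P A) (fst P A) ≫ MonoidalClosed.uncurry g

/-- Pushing a value under an exponential. -/
def pushUnder (P B Q : C) : P ⊗ (ihom B).obj Q ⟶ (ihom B).obj (P ⊗ Q) :=
  curr ((α_ P ((ihom B).obj Q) B).hom ≫ P ◁ uncurr (𝟙 _))

end Exponentials

/-- The context modality: a strong monoidal functor `⟨-⟩ : (ℕ, ≤)ᵒᵖ ⥤ (C ⥤ C)`. -/
structure PastModality (C : Type v) [Category.{w} C] where
  F : ℕᵒᵖ ⥤ C ⥤ C
  η : 𝟭 C ≅ F.obj (op 0)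
  μ : (τ₁ τ₂ : ℕ) → (F.obj (op τ₂) ⋙ F.obj (op τ₁) ≅ F.obj (op (τ₁ + τ₂)))
  η_μ : ∀ (τ : ℕ) (A : C),
    η.hom.app ((F.obj (op τ)).obj A) ≫ (μ 0 τ).hom.app A
      = (F.map (homOfLE (Nat.zero_add τ).le).op).app A
  map_η_μ : ∀ (τ : ℕ) (A : C),
    (F.obj (op τ)).map (η.hom.app A) ≫ (μ τ 0).hom.app A
      = (F.map (homOfLE (Nat.add_zero τ).le).op).app A
  μ_assoc : ∀ (τ₁ τ₂ τ₃ : ℕ) (A : C),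
    (μ τ₁ τ₂).hom.app ((F.obj (op τ₃)).obj A) ≫ (μ (τ₁ + τ₂) τ₃).hom.app A
        ≫ (F.map (homOfLE (Nat.add_assoc τ₁ τ₂ τ₃).ge).op).app A
      = (F.obj (op τ₁)).map ((μ τ₂ τ₃).hom.app A) ≫ (μ τ₁ (τ₂ + τ₃)).hom.app A
  μ_monotone : ∀ {τ₁ τ₁' τ₂ τ₂' : ℕ} (h₁ : τ₁ ≤ τ₁') (h₂ : τ₂ ≤ τ₂') (A : C),
    (μ τ₁' τ₂').hom.app A ≫ (F.map (homOfLE (Nat.add_le_add h₁ h₂)).op).app A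
      = (F.map (homOfLE h₁).op).app ((F.obj (op τ₂')).obj A)
        ≫ (F.obj (op τ₁)).map ((F.map (homOfLE h₂).op).app A) ≫ (μ τ₁ τ₂).hom.app A

/-- The functor `⟨τ⟩`. -/
abbrev PastModality.at {C : Type v} [Category.{w} C] (P : PastModality C) (τ : ℕ) : C ⥤ C :=
  P.F.obj (op τ)

/-- The transformation `⟨τ ≤ τ'⟩ : ⟨τ'⟩ ⟶ ⟨τ⟩`. -/
abbrev PastModality.le {C : Type v} [Category.{w} C] (P : PastModality C) {τ τ' : ℕ}
    (h : τ ≤ τ') : P.at τ' ⟶ P.at τ :=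
  P.F.map (homOfLE h).op

/-- The counit-like transformation `⟨τ⟩ A ⟶ ⟨0⟩ A ⟶ A`. -/
def PastModality.counit {C : Type v} [Category.{w} C] (P : PastModality C) (τ : ℕ) :
    P.at τ ⟶ 𝟭 C :=
  P.le (Nat.zero_le τ) ≫ P.η.inv

/-- The temporal resource modality: a strong monoidal functor `[-] : (ℕ, ≤) ⥤ (C ⥤ C)`. -/
structure FutureModality (C : Type v) [Category.{w} C] where
  F : ℕ ⥤ C ⥤ C
  ε : F.obj 0 ≅ 𝟭 C
  δ : (τ₁ τ₂ : ℕ) → (F.obj (τ₁ + τ₂) ≅ F.obj τ₂ ⋙ F.obj τ₁)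
  δ_ε : ∀ (τ : ℕ) (A : C),
    (δ 0 τ).hom.app A ≫ ε.hom.app ((F.obj τ).obj A)
      = (F.map (homOfLE (Nat.zero_add τ).le)).app A
  δ_map_ε : ∀ (τ : ℕ) (A : C),
    (δ τ 0).hom.app A ≫ (F.obj τ).map (ε.hom.app A)
      = (F.map (homOfLE (Nat.add_zero τ).le)).app A
  δ_assoc : ∀ (τ₁ τ₂ τ₃ : ℕ) (A : C),
    (δ (τ₁ + τ₂) τ₃).hom.app A ≫ (δ τ₁ τ₂).hom.app ((F.obj τ₃).obj A)
      = (F.map (homOfLE (Nat.add_assoc τ₁ τ₂ τ₃).le)).app A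
        ≫ (δ τ₁ (τ₂ + τ₃)).hom.app A ≫ (F.obj τ₁).map ((δ τ₂ τ₃).hom.app A)
  δ_monotone : ∀ {τ₁ τ₁' τ₂ τ₂' : ℕ} (h₁ : τ₁ ≤ τ₁') (h₂ : τ₂ ≤ τ₂') (A : C),
    (F.map (homOfLE (Nat.add_le_add h₁ h₂))).app A ≫ (δ τ₁' τ₂').hom.app A
      = (δ τ₁ τ₂).hom.app A ≫ (F.map (homOfLE h₁)).app ((F.obj τ₂).obj A)
        ≫ (F.obj τ₁').map ((F.map (homOfLE h₂)).app A)

/-- The functor `[τ]`. -/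
abbrev FutureModality.at {C : Type v} [Category.{w} C] (G : FutureModality C) (τ : ℕ) : C ⥤ C :=
  G.F.obj τ

/-- The transformation `[τ ≤ τ'] : [τ] ⟶ [τ']`. -/
abbrev FutureModality.le {C : Type v} [Category.{w} C] (G : FutureModality C) {τ τ' : ℕ}
    (h : τ ≤ τ') : G.at τ ⟶ G.at τ' :=
  G.F.map (homOfLE h)

/-- The modal part of a model: the two modalities and the adjunctions `⟨τ⟩ ⊣ [τ]`, interacting
well with the strong monoidal structures. -/
structure ModalModel (C : Type v) [Category.{w} C] where
  past : PastModality C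
  fut : FutureModality C
  adj : (τ : ℕ) → (past.at τ ⊣ fut.at τ)
  unit_zero_le : ∀ (τ : ℕ) (A : C),
    fut.ε.hom.app ((past.at 0).obj A) ≫ past.η.inv.app A ≫ (adj τ).unit.app A
        ≫ (fut.at τ).map ((past.le (Nat.zero_le τ)).app A)
      = (fut.le (Nat.zero_le τ)).app ((past.at 0).obj A)
  counit_zero_le : ∀ (τ : ℕ) (A : C),
    (adj τ).counit.app A ≫ fut.ε.inv.app A ≫ past.η.hom.app ((fut.at 0).obj A)
        ≫ (past.at 0).map ((fut.le (Nat.zero_le τ)).app A)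
      = (past.le (Nat.zero_le τ)).app ((fut.at τ).obj A)
  unit_add : ∀ (τ₁ τ₂ : ℕ) (A : C),
    (adj τ₁).unit.app A ≫ (fut.at τ₁).map ((adj τ₂).unit.app ((past.at τ₁).obj A))
        ≫ (fut.at τ₁).map ((fut.at τ₂).map ((past.μ τ₂ τ₁).hom.app A))
      = (adj (τ₁ + τ₂)).unit.app A
        ≫ (fut.δ τ₁ τ₂).hom.app ((past.at (τ₁ + τ₂)).obj A)
        ≫ (fut.at τ₁).map ((fut.at τ₂).map ((past.le (Nat.add_comm τ₂ τ₁).le).app A))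
  counit_add : ∀ (τ₁ τ₂ : ℕ) (A : C),
    (past.at τ₁).map ((past.at τ₂).map
          ((fut.le (Nat.add_comm τ₁ τ₂).le).app A ≫ (fut.δ τ₂ τ₁).hom.app A))
        ≫ (past.at τ₁).map ((adj τ₂).counit.app ((fut.at τ₁).obj A)) ≫ (adj τ₁).counit.app A
      = (past.μ τ₁ τ₂).hom.app ((fut.at (τ₁ + τ₂)).obj A) ≫ (adj (τ₁ + τ₂)).counit.app A

/-- `[τ]` is monoidal for products, being a right adjoint: `[τ] A ⊗ [τ] B ⟶ [τ] (A ⊗ B)` is the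
transpose of `⟨τ⟩ ([τ] A ⊗ [τ] B) ⟶ A ⊗ B`. -/
def ModalModel.m {C : Type v} [Category.{w} C] [CartesianMonoidalCategory C] (M : ModalModel C)
    (A B : C) (τ : ℕ) :
    (M.fut.at τ).obj A ⊗ (M.fut.at τ).obj B ⟶ (M.fut.at τ).obj (A ⊗ B) :=
  (M.adj τ).homEquiv _ _
    (lift ((M.past.at τ).map (fst _ _) ≫ (M.adj τ).counit.app A)
      ((M.past.at τ).map (snd _ _) ≫ (M.adj τ).counit.app B))

/-- The identity `T τ A = T τ' A` for equal grades, as a morphism. -/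
abbrev gradeCast {C : Type v} [Category.{w} C] (T : ℕ → C ⥤ C) {τ τ' : ℕ} (h : τ = τ') :
    T τ ⟶ T τ' :=
  eqToHom (congrArg T h)

/-- A modal model with a `[-]`-strong graded monad `T`. -/
structure StrongGradedMonadModel (C : Type v) [Category.{w} C] [CartesianMonoidalCategory C]
    extends ModalModel C where
  T : ℕ → C ⥤ C
  ηT : 𝟭 C ⟶ T 0
  μT : (τ₁ τ₂ : ℕ) → (T τ₂ ⋙ T τ₁ ⟶ T (τ₁ + τ₂))
  str : (A B : C) → (τ : ℕ) → ((fut.at τ).obj A ⊗ (T τ).obj B ⟶ (T τ).obj (A ⊗ B))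
  str_natural : ∀ {A A' B B' : C} (f : A ⟶ A') (g : B ⟶ B') (τ : ℕ),
    ((fut.at τ).map f ⊗ₘ (T τ).map g) ≫ str A' B' τ = str A B τ ≫ (T τ).map (f ⊗ₘ g)
  ηT_μT : ∀ (τ : ℕ) (A : C),
    ηT.app ((T τ).obj A) ≫ (μT 0 τ).app A = (gradeCast T (Nat.zero_add τ).symm).app A
  map_ηT_μT : ∀ (τ : ℕ) (A : C),
    (T τ).map (ηT.app A) ≫ (μT τ 0).app A = (gradeCast T (Nat.add_zero τ).symm).app A
  μT_assoc : ∀ (τ₁ τ₂ τ₃ : ℕ) (A : C),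
    (μT τ₁ τ₂).app ((T τ₃).obj A) ≫ (μT (τ₁ + τ₂) τ₃).app A
        ≫ (gradeCast T (Nat.add_assoc τ₁ τ₂ τ₃)).app A
      = (T τ₁).map ((μT τ₂ τ₃).app A) ≫ (μT τ₁ (τ₂ + τ₃)).app A
  str_ηT : ∀ A B : C,
    (fut.ε.inv.app A ⊗ₘ ηT.app B) ≫ str A B 0 = ηT.app (A ⊗ B)
  str_snd : ∀ (A B : C) (τ : ℕ),
    str A B τ ≫ (T τ).map (snd A B) = snd _ _
  str_μT : ∀ (A B : C) (τ₁ τ₂ : ℕ),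
    str ((fut.at τ₂).obj A) ((T τ₂).obj B) τ₁ ≫ (T τ₁).map (str A B τ₂) ≫ (μT τ₁ τ₂).app (A ⊗ B)
      = ((fut.δ τ₁ τ₂).inv.app A ⊗ₘ (μT τ₁ τ₂).app B) ≫ str A B (τ₁ + τ₂)
  str_assoc : ∀ (A B D : C) (τ : ℕ),
    (α_ _ _ _).inv ≫ (toModalModel.m A B τ ▷ (T τ).obj D) ≫ str (A ⊗ B) D τ
        ≫ (T τ).map (α_ A B D).hom
      = ((fut.at τ).obj A ◁ str B D τ) ≫ str A (B ⊗ D) τ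

/-- A model of the types of the calculus: also base types are interpreted. -/
structure TypeModel (S : Signature.{u}) (C : Type v) [Category.{w} C]
    [CartesianMonoidalCategory C] [MonoidalClosed C] extends StrongGradedMonadModel C where
  base : S.Base → C

/-- The interpretation of value types. -/
def TypeModel.ty {S : Signature.{u}} {C : Type v} [Category.{w} C]
    [CartesianMonoidalCategory C] [MonoidalClosed C] (M : TypeModel S C) : VTy S.Base → C
  | .base b => M.base b
  | .unit => 𝟙_ C
  | .prod X Y => M.ty X ⊗ M.ty Y
  | .fn X Y τ => (ihom (M.ty X)).obj ((M.T τ).obj (M.ty Y))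
  | .box τ X => (M.fut.at τ).obj (M.ty X)

/-- The interpretation of ground types. -/
abbrev TypeModel.gty {S : Signature.{u}} {C : Type v} [Category.{w} C]
    [CartesianMonoidalCategory C] [MonoidalClosed C] (M : TypeModel S C) (A : GTy S.Base) : C :=
  M.ty A.toVTy

section Handlers

/- The second assumption is the instance of the first for small index sets (and follows from it);
it is listed for the products over `ℕ` and over the arguments of a constant. -/
variable {S : Signature.{u}} {C : Type v} [Category.{w} C]
  [CartesianMonoidalCategory C] [MonoidalClosed C] [HasProducts.{u} C] [HasProducts.{0} C]

/-- The type of clauses for the operation `o` with continuations of grade `τ''`. -/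
abbrev TypeModel.clauseObj (M : TypeModel S C) (A : C) (o : S.Op) (τ'' : ℕ) : C :=
  (ihom (M.gty (S.opArg o) ⊗
      (M.fut.at (S.opTime o)).obj ((ihom (M.gty (S.opRes o))).obj ((M.T τ'').obj A)))).obj
    ((M.T (S.opTime o + τ'')).obj A)

/-- The object of operation clauses, `Π_op Π_τ''` of the above. -/
noncomputable abbrev TypeModel.handlerObj (M : TypeModel S C) (A : C) : C :=
  ∏ᶜ fun o : S.Op => ∏ᶜ fun τ'' : ℕ => M.clauseObj A o τ''

end Handlers

/-- A model of the calculus: set-indexed products, constants, algebraic operations, delays, and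
handling morphisms. -/
structure Model (S : Signature.{u}) (C : Type v) [Category.{w} C]
    [CartesianMonoidalCategory C] [MonoidalClosed C] [HasProducts.{u} C] [HasProducts.{0} C]
    extends TypeModel S C where
  cst : (f : S.Cst) →
    ((∏ᶜ fun i : Fin (S.arity f) => toTypeModel.gty (S.cstDom f i)) ⟶
      toTypeModel.gty (S.cstCod f))
  /-- `A_op ⊗ [τ_op] (B_op ⇒ T τ A) ⟶ T (τ_op + τ) A`, natural in `A`. -/
  opT : (o : S.Op) → (τ : ℕ) →
    (T τ ⋙ ihom (toTypeModel.gty (S.opRes o)) ⋙ fut.at (S.opTime o) ⋙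
        tensorLeft (toTypeModel.gty (S.opArg o)) ⟶ T (S.opTime o + τ))
  /-- `[τ] (T τ' A) ⟶ T (τ + τ') A`, natural in `A`. -/
  delayT : (τ τ' : ℕ) → (T τ' ⋙ fut.at τ ⟶ T (τ + τ'))
  opT_μT : ∀ (o : S.Op) (τ τ' : ℕ) (A : C),
    (opT o τ).app ((T τ').obj A) ≫ (μT (S.opTime o + τ) τ').app A
      = (toTypeModel.gty (S.opArg o) ◁
            (fut.at (S.opTime o)).map ((ihom (toTypeModel.gty (S.opRes o))).map
              ((μT τ τ').app A)))
          ≫ (opT o (τ + τ')).app A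
          ≫ (gradeCast T (Nat.add_assoc (S.opTime o) τ τ').symm).app A
  delayT_μT : ∀ (τ τ' τ'' : ℕ) (A : C),
    (delayT τ τ').app ((T τ'').obj A) ≫ (μT (τ + τ') τ'').app A
      = (fut.at τ).map ((μT τ' τ'').app A) ≫ (delayT τ (τ' + τ'')).app A
          ≫ (gradeCast T (Nat.add_assoc τ τ' τ'').symm).app A
  str_opT : ∀ (o : S.Op) (τ : ℕ) (A B : C),
    ((fut.at (S.opTime o + τ)).obj A ◁ (opT o τ).app B) ≫ str A B (S.opTime o + τ)
      = lift (snd _ _ ≫ fst _ _)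
            (lift (fst _ _ ≫ (fut.δ (S.opTime o) τ).hom.app A) (snd _ _ ≫ snd _ _)
              ≫ toModalModel.m ((fut.at τ).obj A)
                  ((ihom (toTypeModel.gty (S.opRes o))).obj ((T τ).obj B)) (S.opTime o)
              ≫ (fut.at (S.opTime o)).map
                  (pushUnder ((fut.at τ).obj A) (toTypeModel.gty (S.opRes o)) ((T τ).obj B)
                    ≫ (ihom (toTypeModel.gty (S.opRes o))).map (str A B τ)))
          ≫ (opT o τ).app (A ⊗ B)
  str_delayT : ∀ (τ τ' : ℕ) (A B : C),
    ((fut.at (τ + τ')).obj A ◁ (delayT τ τ').app B) ≫ str A B (τ + τ')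
      = ((fut.δ τ τ').hom.app A ▷ (fut.at τ).obj ((T τ').obj B))
          ≫ toModalModel.m ((fut.at τ').obj A) ((T τ').obj B) τ
          ≫ (fut.at τ).map (str A B τ') ≫ (delayT τ τ').app (A ⊗ B)
  /-- The handling morphisms. -/
  χ : (A : C) → (τ τ' : ℕ) →
    (toTypeModel.handlerObj A ⟶ (ihom ((T τ).obj ((T τ').obj A))).obj ((T (τ + τ')).obj A))
  χ_ηT : ∀ (A : C) (τ : ℕ),
    (toTypeModel.handlerObj A ◁ ηT.app ((T τ).obj A)) ≫ uncurr (χ A 0 τ)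
      = snd _ _ ≫ (gradeCast T (Nat.zero_add τ).symm).app A
  χ_delayT : ∀ (A : C) (τ τ' τ'' : ℕ),
    (toTypeModel.handlerObj A ◁ (delayT τ τ').app ((T τ'').obj A)) ≫ uncurr (χ A (τ + τ') τ'')
      = ((adj τ).unit.app (toTypeModel.handlerObj A)
            ▷ (fut.at τ).obj ((T τ').obj ((T τ'').obj A)))
          ≫ toModalModel.m ((past.at τ).obj (toTypeModel.handlerObj A))
              ((T τ').obj ((T τ'').obj A)) τ
          ≫ (fut.at τ).map
              (((past.counit τ).app (toTypeModel.handlerObj A) ▷ (T τ').obj ((T τ'').obj A))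
                ≫ uncurr (χ A τ' τ''))
          ≫ (delayT τ (τ' + τ'')).app A
          ≫ (gradeCast T (Nat.add_assoc τ τ' τ'').symm).app A
  χ_opT : ∀ (A : C) (o : S.Op) (τ τ' : ℕ),
    (toTypeModel.handlerObj A ◁ (opT o τ).app ((T τ').obj A)) ≫ uncurr (χ A (S.opTime o + τ) τ')
      = lift (fst _ _ ≫ Pi.π (fun o : S.Op => ∏ᶜ fun τ'' : ℕ => toTypeModel.clauseObj A o τ'') o
              ≫ Pi.π (fun τ'' : ℕ => toTypeModel.clauseObj A o τ'') (τ + τ'))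
            (lift (snd _ _ ≫ fst _ _)
              (lift (fst _ _ ≫ (adj (S.opTime o)).unit.app (toTypeModel.handlerObj A))
                  (snd _ _ ≫ snd _ _)
                ≫ toModalModel.m ((past.at (S.opTime o)).obj (toTypeModel.handlerObj A))
                    ((ihom (toTypeModel.gty (S.opRes o))).obj ((T τ).obj ((T τ').obj A)))
                    (S.opTime o)
                ≫ (fut.at (S.opTime o)).map
                    (((past.counit (S.opTime o)).app (toTypeModel.handlerObj A) ▷ _)
                      ≫ pushUnder (toTypeModel.handlerObj A) (toTypeModel.gty (S.opRes o))
                          ((T τ).obj ((T τ').obj A))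
                      ≫ (ihom (toTypeModel.gty (S.opRes o))).map (uncurr (χ A τ τ')))))
          ≫ uncurr (𝟙 (toTypeModel.clauseObj A o (τ + τ')))
          ≫ (gradeCast T (Nat.add_assoc (S.opTime o) τ τ').symm).app A

/-! # Interpretation -/

noncomputable section Interpretation

variable {S : Signature.{u}} {C : Type v} [Category.{w} C]
  [CartesianMonoidalCategory C] [MonoidalClosed C]

namespace TypeModel

variable (M : TypeModel S C)

/-- The interpretation of contexts as functors. -/
def ctx : Ctx S.Base → C ⥤ C
  | .nil => 𝟭 C
  | .var Γ X => ctx Γ ⋙ tensorRight (M.ty X)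
  | .mod Γ τ => ctx Γ ⋙ M.past.at τ

/-- The natural isomorphism `⟦Γ, Γ'⟧ A ≅ ⟦Γ'⟧ (⟦Γ⟧ A)`. -/
def ι (Γ : Ctx S.Base) : (Γ' : Ctx S.Base) → (M.ctx (Γ.append Γ') ≅ M.ctx Γ ⋙ M.ctx Γ')
  | .nil => Iso.refl (M.ctx Γ)
  | .var Γ' X => Functor.isoWhiskerRight (ι Γ Γ') (tensorRight (M.ty X))
  | .mod Γ' τ => Functor.isoWhiskerRight (ι Γ Γ') (M.past.at τ)

/-- The transformation `⟦Γ⟧ A ⟶ ⟨time Γ⟩ A` that extracts and collapses all modalities. -/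
def e : (Γ : Ctx S.Base) → (A : C) → ((M.ctx Γ).obj A ⟶ (M.past.at Γ.time).obj A)
  | .nil, A => M.past.η.hom.app A
  | .var Γ X, A => fst ((M.ctx Γ).obj A) (M.ty X) ≫ e Γ A
  | .mod Γ τ, A =>
      (M.past.at τ).map (e Γ A) ≫ (M.past.μ τ Γ.time).hom.app A
        ≫ (M.past.le (Nat.add_comm Γ.time τ).le).app A

/-- The transformation `⟦Γ⟧ A ⟶ ⟨τ⟩ (⟦Γ - τ⟧ A)`, for `τ ≤ time Γ`, that extracts and collapses
`τ` worth of modalities. -/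
def ηPRA : (Γ : Ctx S.Base) → (τ : ℕ) → τ ≤ Γ.time → (A : C) →
    ((M.ctx Γ).obj A ⟶ (M.past.at τ).obj ((M.ctx (Γ.minus τ)).obj A))
  | .nil, 0, _, A => M.past.η.hom.app A
  | .var Γ X, 0, _, A => M.past.η.hom.app ((M.ctx (Γ.var X)).obj A)
  | .mod Γ τ', 0, _, A => M.past.η.hom.app ((M.ctx (Γ.mod τ')).obj A)
  | .nil, t + 1, h, _ => absurd h (Nat.not_succ_le_zero t)
  | .var Γ X, t + 1, h, A => fst ((M.ctx Γ).obj A) (M.ty X) ≫ ηPRA Γ (t + 1) h A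
  | .mod Γ τ', t + 1, h, A =>
      if h' : t + 1 ≤ τ' then
        (M.past.le (Nat.add_sub_of_le h').le).app ((M.ctx Γ).obj A)
          ≫ (M.past.μ (t + 1) (τ' - (t + 1))).inv.app ((M.ctx Γ).obj A)
          ≫ eqToHom (congrArg (fun Δ => (M.past.at (t + 1)).obj ((M.ctx Δ).obj A))
              (Ctx.minus_mod_of_le Γ h').symm)
      else
        (M.past.at τ').map (ηPRA Γ (t + 1 - τ') (Nat.sub_le_iff_le_add.mpr h) A)
          ≫ (M.past.μ τ' (t + 1 - τ')).hom.app ((M.ctx (Γ.minus (t + 1 - τ'))).obj A)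
          ≫ (M.past.le (Nat.add_sub_of_le (Nat.le_of_not_le h')).ge).app
              ((M.ctx (Γ.minus (t + 1 - τ'))).obj A)
          ≫ eqToHom (congrArg (fun Δ => (M.past.at (t + 1)).obj ((M.ctx Δ).obj A))
              (Ctx.minus_mod_of_not_le Γ h').symm)

end TypeModel

namespace Model

variable [HasProducts.{u} C] [HasProducts.{0} C] (M : Model S C)

/-- The object `⟦Γ⟧ 1`. -/
abbrev env (Γ : Ctx S.Base) : C := (M.ctx Γ).obj (𝟙_ C)

/- The interpretation of values and computations, by recursion on typing derivations. -/
mutual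
/-- The interpretation `⟦Γ ⊢ V : X⟧ : ⟦Γ⟧ 1 ⟶ ⟦X⟧`. -/
def val {Γ : Ctx S.Base} {V : Val S} {X : VTy S.Base} :
    VTyping S Γ V X → (M.env Γ ⟶ M.ty X)
  | .var (X := X) Γ₁ Γ₂ hΔ _ =>
      eqToHom (congrArg M.env hΔ)
        ≫ (M.ι (Γ₁.var X) Γ₂).hom.app (𝟙_ C)
        ≫ M.e Γ₂ (M.env (Γ₁.var X))
        ≫ (M.past.counit Γ₂.time).app (M.env (Γ₁.var X))
        ≫ snd (M.env Γ₁) (M.ty X)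
  | .const f dVs => Pi.lift (fun i => val (dVs i)) ≫ M.cst f
  | .unit => toUnit _
  | .pair dV dW => lift (val dV) (val dW)
  | .fn dM => curr (cmp dM)
  | .box (Γ := Γ) (τ := τ) dV => (M.adj τ).unit.app (M.env Γ) ≫ (M.fut.at τ).map (val dV)
/-- The interpretation `⟦Γ ⊢ M : X ! τ⟧ : ⟦Γ⟧ 1 ⟶ T τ ⟦X⟧`. -/
def cmp {Γ : Ctx S.Base} {N : Cmp S} {X : VTy S.Base} {τ : ℕ} :
    CTyping S Γ N X τ → (M.env Γ ⟶ (M.T τ).obj (M.ty X))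
  | .ret dV => val dV ≫ M.ηT.app _
  | .letIn (Γ := Γ) (X := X) (Y := Y) (τ := τ) (τ' := τ') dM dN =>
      lift ((M.adj τ).unit.app (M.env Γ)) (cmp dM)
        ≫ M.str ((M.past.at τ).obj (M.env Γ)) (M.ty X) τ
        ≫ (M.T τ).map (cmp dN)
        ≫ (M.μT τ τ').app (M.ty Y)
  | .app dV dW => lift (val dV) (val dW) ≫ uncurr (𝟙 _)
  | .matchPair (Γ := Γ) (X := X) (Y := Y) dV dN =>
      lift (𝟙 (M.env Γ)) (val dV) ≫ (α_ (M.env Γ) (M.ty X) (M.ty Y)).inv ≫ cmp dN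
  | .op (Γ := Γ) (X := X) (τ := τ) o dV dM =>
      lift (val dV) ((M.adj (S.opTime o)).unit.app (M.env Γ))
        ≫ (M.gty (S.opArg o) ◁ (M.fut.at (S.opTime o)).map (curr (cmp dM)))
        ≫ (M.opT o τ).app (M.ty X)
  | .delay (Γ := Γ) (X := X) (τ := τ) (τ' := τ') dM =>
      (M.adj τ).unit.app (M.env Γ) ≫ (M.fut.at τ).map (cmp dM) ≫ (M.delayT τ τ').app (M.ty X)
  | .handle (Γ := Γ) (X := X) (Y := Y) (τ := τ) (τ' := τ') dM dN dH =>
      lift (𝟙 (M.env Γ)) (lift ((M.adj τ).unit.app (M.env Γ)) (cmp dM))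
        ≫ (M.env Γ ◁ M.str ((M.past.at τ).obj (M.env Γ)) (M.ty X) τ)
        ≫ (M.env Γ ◁ (M.T τ).map (cmp dN))
        ≫ ((Pi.lift fun o => Pi.lift fun τ'' =>
              (curr ((α_ _ _ _).inv ≫ cmp (dH o τ'')) :
                M.env Γ ⟶ M.clauseObj (M.ty Y) o τ'')) ▷ _)
        ≫ uncurr (M.χ (M.ty Y) τ τ')
  | .unbox (Γ := Γ) (X := X) (τ := τ) hτ _ dV dN =>
      lift (𝟙 (M.env Γ)) (M.ηPRA Γ τ hτ (𝟙_ C))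
        ≫ (M.env Γ ◁ (M.past.at τ).map (val dV))
        ≫ (M.env Γ ◁ (M.adj τ).counit.app (M.ty X))
        ≫ cmp dN
end

end Model

end Interpretation

end LambdaTau

open LambdaTau

-- The proof is an induction on the derivation of `J`, but the fixed shape `Γ, x : X, Γ'` is not
-- stable under the rules. In `unbox` the subterm lives in an earlier context. Cutting `Γ, x : X,
-- Γ'` may stop inside `Γ'`, where the substitution continues with a shorter tail, or may reach past
-- `x`, where nothing is left to substitute. Hence the induction is run for a whole class of pairs
-- `(σ, f)`, a simultaneous substitution and the morphism of environments that it denotes. The class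
-- must be stable under extending both contexts, must send variables to values with the right
-- denotation, and must restrict to all earlier contexts, compatibly with the maps `⟦Γ⟧ 1 ⟶ ⟨τ⟩ ⟦Γ -
-- τ⟧ 1`. For such a class (`IsSubstClass`), `exists_val` and `exists_cmp` follow from naturality in
-- the environment of each clause of the interpretation.
--
-- This theorem is used twice. The first class consists of weakenings: plugging `W` in under `Γ'`
-- weakens it by the variables and modalities of `Γ'`. The second consists of the substitutions
-- `[W/x]` together with the weakenings. For weakenings, restriction to earlier contexts is the hard
-- point (`Wk.minus`): cutting `Γ, ⟨σ⟩` by `τ` removes less of `Γ` than cutting `Γ` does, so passage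
-- from an earlier context must itself count as a weakening. The required squares commute because
-- going back by `s` and then by `t` is going back by `s + t` (`toPast_bind`), a coherence statement
-- about the graded structure of `⟨-⟩`.
--
-- The induction only produces one derivation with the right denotation. Typing derivations are
-- unique (`VTyping.unique`, `CTyping.unique`), so the equation holds for every derivation.

namespace LambdaTau

/-! # Renaming and simultaneous substitution -/

/-- The extension of a renaming under a binder. -/
def liftRen (r : ℕ → ℕ) : ℕ → ℕ
  | 0 => 0
  | n + 1 => r n + 1

theorem liftRen_comp (s r : ℕ → ℕ) : liftRen s ∘ liftRen r = liftRen (s ∘ r) := by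
  funext n; cases n <;> rfl

/-- The renaming performed by `shift k c`. -/
def shiftRen (k c n : ℕ) : ℕ := if n < c then n else n + k

theorem liftRen_shiftRen (k c : ℕ) : liftRen (shiftRen k c) = shiftRen k (c + 1) := by
  funext n
  cases n with
  | zero => simp [liftRen, shiftRen]
  | succ n => simp only [liftRen, shiftRen]; split_ifs <;> omega

theorem shiftRen_zero (k : ℕ) : shiftRen k 0 = fun n => n + k := by
  funext n; simp [shiftRen]

theorem liftRen_injective {r : ℕ → ℕ} (h : Function.Injective r) :
    Function.Injective (liftRen r) := by
  intro a b hab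
  cases a <;> cases b <;> simp_all [liftRen]
  exact h hab

/- Renaming of free variables. -/
mutual
def Val.rename {S : Signature.{u}} : Val S → (ℕ → ℕ) → Val S
  | .var n, r => .var (r n)
  | .const f Vs, r => .const f fun i => (Vs i).rename r
  | .unit, _ => .unit
  | .pair V W, r => .pair (V.rename r) (W.rename r)
  | .fn X M, r => .fn X (M.rename (liftRen r))
  | .box τ V, r => .box τ (V.rename r)
def Cmp.rename {S : Signature.{u}} : Cmp S → (ℕ → ℕ) → Cmp S
  | .ret V, r => .ret (V.rename r)
  | .letIn M N, r => .letIn (M.rename r) (N.rename (liftRen r))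
  | .app V W, r => .app (V.rename r) (W.rename r)
  | .matchPair V N, r => .matchPair (V.rename r) (N.rename (liftRen (liftRen r)))
  | .op o V M, r => .op o (V.rename r) (M.rename (liftRen r))
  | .delay τ M, r => .delay τ (M.rename r)
  | .handle M H N, r =>
      .handle (M.rename r) (fun o => (H o).rename (liftRen (liftRen r))) (N.rename (liftRen r))
  | .unbox τ V N, r => .unbox τ (V.rename r) (N.rename (liftRen r))
end

mutual
theorem Val.shift_eq_rename {S : Signature.{u}} :
    ∀ (V : Val S) (k c : ℕ), V.shift k c = V.rename (shiftRen k c)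
  | .var n, k, c => rfl
  | .const f Vs, k, c => by
      simp only [Val.shift, Val.rename, fun i => Val.shift_eq_rename (Vs i)]
  | .unit, _, _ => rfl
  | .pair V W, k, c => by
      simp only [Val.shift, Val.rename, Val.shift_eq_rename V, Val.shift_eq_rename W]
  | .fn X M, k, c => by
      simp only [Val.shift, Val.rename, Cmp.shift_eq_rename M, liftRen_shiftRen]
  | .box τ V, k, c => by simp only [Val.shift, Val.rename, Val.shift_eq_rename V]
theorem Cmp.shift_eq_rename {S : Signature.{u}} :
    ∀ (M : Cmp S) (k c : ℕ), M.shift k c = M.rename (shiftRen k c)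
  | .ret V, k, c => by simp only [Cmp.shift, Cmp.rename, Val.shift_eq_rename V]
  | .letIn M N, k, c => by
      simp only [Cmp.shift, Cmp.rename, Cmp.shift_eq_rename M, Cmp.shift_eq_rename N,
        liftRen_shiftRen]
  | .app V W, k, c => by
      simp only [Cmp.shift, Cmp.rename, Val.shift_eq_rename V, Val.shift_eq_rename W]
  | .matchPair V N, k, c => by
      simp only [Cmp.shift, Cmp.rename, Val.shift_eq_rename V, Cmp.shift_eq_rename N,
        liftRen_shiftRen]
  | .op o V M, k, c => by
      simp only [Cmp.shift, Cmp.rename, Val.shift_eq_rename V, Cmp.shift_eq_rename M,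
        liftRen_shiftRen]
  | .delay τ M, k, c => by simp only [Cmp.shift, Cmp.rename, Cmp.shift_eq_rename M]
  | .handle M H N, k, c => by
      simp only [Cmp.shift, Cmp.rename, Cmp.shift_eq_rename M, Cmp.shift_eq_rename N,
        fun o => Cmp.shift_eq_rename (H o), liftRen_shiftRen]
  | .unbox τ V N, k, c => by
      simp only [Cmp.shift, Cmp.rename, Val.shift_eq_rename V, Cmp.shift_eq_rename N,
        liftRen_shiftRen]
end

mutual
theorem Val.rename_rename {S : Signature.{u}} :
    ∀ (V : Val S) (r s : ℕ → ℕ), (V.rename r).rename s = V.rename (s ∘ r)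
  | .var n, r, s => rfl
  | .const f Vs, r, s => by
      simp only [Val.rename, fun i => Val.rename_rename (Vs i)]
  | .unit, _, _ => rfl
  | .pair V W, r, s => by
      simp only [Val.rename, Val.rename_rename V, Val.rename_rename W]
  | .fn X M, r, s => by
      simp only [Val.rename, Cmp.rename_rename M, liftRen_comp]
  | .box τ V, r, s => by simp only [Val.rename, Val.rename_rename V]
theorem Cmp.rename_rename {S : Signature.{u}} :
    ∀ (M : Cmp S) (r s : ℕ → ℕ), (M.rename r).rename s = M.rename (s ∘ r)
  | .ret V, r, s => by simp only [Cmp.rename, Val.rename_rename V]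
  | .letIn M N, r, s => by
      simp only [Cmp.rename, Cmp.rename_rename M, Cmp.rename_rename N, liftRen_comp]
  | .app V W, r, s => by
      simp only [Cmp.rename, Val.rename_rename V, Val.rename_rename W]
  | .matchPair V N, r, s => by
      simp only [Cmp.rename, Val.rename_rename V, Cmp.rename_rename N, liftRen_comp]
  | .op o V M, r, s => by
      simp only [Cmp.rename, Val.rename_rename V, Cmp.rename_rename M, liftRen_comp]
  | .delay τ M, r, s => by simp only [Cmp.rename, Cmp.rename_rename M]
  | .handle M H N, r, s => by
      simp only [Cmp.rename, Cmp.rename_rename M, Cmp.rename_rename N,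
        fun o => Cmp.rename_rename (H o), liftRen_comp]
  | .unbox τ V N, r, s => by
      simp only [Cmp.rename, Val.rename_rename V, Cmp.rename_rename N, liftRen_comp]
end

theorem Val.shift_shift {S : Signature.{u}} (V : Val S) (j k : ℕ) :
    (V.shift j 0).shift k 0 = V.shift (j + k) 0 := by
  simp only [Val.shift_eq_rename, Val.rename_rename, shiftRen_zero]
  congr 1; funext n; simp [Nat.add_assoc]

mutual
theorem Val.rename_injective {S : Signature.{u}} : ∀ (V V' : Val S) {r : ℕ → ℕ},
    Function.Injective r → V.rename r = V'.rename r → V = V'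
  | .var n, V', r, hr, h => by
      cases V' <;> simp [Val.rename] at h
      exact congrArg _ (hr h)
  | .const f Vs, V', r, hr, h => by
      cases V' <;> simp [Val.rename] at h
      obtain ⟨rfl, h⟩ := h
      exact congrArg _ (funext fun i =>
        Val.rename_injective (Vs i) _ hr (congrFun (eq_of_heq h) i))
  | .unit, V', r, hr, h => by
      cases V' <;> simp [Val.rename] at h
      rfl
  | .pair V W, V', r, hr, h => by
      cases V' <;> simp [Val.rename] at h
      rw [Val.rename_injective V _ hr h.1, Val.rename_injective W _ hr h.2]
  | .fn X M, V', r, hr, h => by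
      cases V' <;> simp [Val.rename] at h
      rw [h.1, Cmp.rename_injective M _ (liftRen_injective hr) h.2]
  | .box τ V, V', r, hr, h => by
      cases V' <;> simp [Val.rename] at h
      rw [h.1, Val.rename_injective V _ hr h.2]
theorem Cmp.rename_injective {S : Signature.{u}} : ∀ (M M' : Cmp S) {r : ℕ → ℕ},
    Function.Injective r → M.rename r = M'.rename r → M = M'
  | .ret V, M', r, hr, h => by
      cases M' <;> simp [Cmp.rename] at h
      rw [Val.rename_injective V _ hr h]
  | .letIn M N, M', r, hr, h => by
      cases M' <;> simp [Cmp.rename] at h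
      rw [Cmp.rename_injective M _ hr h.1, Cmp.rename_injective N _ (liftRen_injective hr) h.2]
  | .app V W, M', r, hr, h => by
      cases M' <;> simp [Cmp.rename] at h
      rw [Val.rename_injective V _ hr h.1, Val.rename_injective W _ hr h.2]
  | .matchPair V N, M', r, hr, h => by
      cases M' <;> simp [Cmp.rename] at h
      rw [Val.rename_injective V _ hr h.1,
        Cmp.rename_injective N _ (liftRen_injective (liftRen_injective hr)) h.2]
  | .op o V M, M', r, hr, h => by
      cases M' <;> simp [Cmp.rename] at h
      rw [h.1, Val.rename_injective V _ hr h.2.1,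
        Cmp.rename_injective M _ (liftRen_injective hr) h.2.2]
  | .delay τ M, M', r, hr, h => by
      cases M' <;> simp [Cmp.rename] at h
      rw [h.1, Cmp.rename_injective M _ hr h.2]
  | .handle M H N, M', r, hr, h => by
      cases M' <;> simp [Cmp.rename] at h
      rw [Cmp.rename_injective M _ hr h.1, Cmp.rename_injective N _ (liftRen_injective hr) h.2.2,
        funext fun o => Cmp.rename_injective (H o) _
          (liftRen_injective (liftRen_injective hr)) (congrFun h.2.1 o)]
  | .unbox τ V N, M', r, hr, h => by
      cases M' <;> simp [Cmp.rename] at h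
      rw [h.1, Val.rename_injective V _ hr h.2.1,
        Cmp.rename_injective N _ (liftRen_injective hr) h.2.2]
end

/-- The `unbox` rule presents its value as a shift of a value of the earlier context; injectivity
recovers that value, which uniqueness of derivations needs. -/
theorem Val.shift_injective {S : Signature.{u}} {V V' : Val S} {k : ℕ}
    (h : V.shift k 0 = V'.shift k 0) : V = V' := by
  rw [Val.shift_eq_rename, Val.shift_eq_rename, shiftRen_zero] at h
  exact Val.rename_injective V V' (add_left_injective k) h

/-- Shifting by `0` is idempotent and injective, hence the identity. -/
theorem Val.shift_zero {S : Signature.{u}} (V : Val S) : V.shift 0 0 = V :=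
  Val.shift_injective (Val.shift_shift V 0 0)

/-- The extension of a substitution under a binder. -/
def liftSub {S : Signature.{u}} (σ : ℕ → Val S) : ℕ → Val S
  | 0 => .var 0
  | n + 1 => (σ n).shift 1 0

/- Simultaneous substitution. -/
mutual
def Val.sbst {S : Signature.{u}} : Val S → (ℕ → Val S) → Val S
  | .var n, σ => σ n
  | .const f Vs, σ => .const f fun i => (Vs i).sbst σ
  | .unit, _ => .unit
  | .pair V W, σ => .pair (V.sbst σ) (W.sbst σ)
  | .fn X M, σ => .fn X (M.sbst (liftSub σ))
  | .box τ V, σ => .box τ (V.sbst σ)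
def Cmp.sbst {S : Signature.{u}} : Cmp S → (ℕ → Val S) → Cmp S
  | .ret V, σ => .ret (V.sbst σ)
  | .letIn M N, σ => .letIn (M.sbst σ) (N.sbst (liftSub σ))
  | .app V W, σ => .app (V.sbst σ) (W.sbst σ)
  | .matchPair V N, σ => .matchPair (V.sbst σ) (N.sbst (liftSub (liftSub σ)))
  | .op o V M, σ => .op o (V.sbst σ) (M.sbst (liftSub σ))
  | .delay τ M, σ => .delay τ (M.sbst σ)
  | .handle M H N, σ =>
      .handle (M.sbst σ) (fun o => (H o).sbst (liftSub (liftSub σ))) (N.sbst (liftSub σ))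
  | .unbox τ V N, σ => .unbox τ (V.sbst σ) (N.sbst (liftSub σ))
end

theorem liftSub_var {S : Signature.{u}} (r : ℕ → ℕ) :
    liftSub (fun n => (.var (r n) : Val S)) = fun n => .var (liftRen r n) := by
  funext n; cases n <;> rfl

mutual
theorem Val.sbst_var {S : Signature.{u}} :
    ∀ (V : Val S) (r : ℕ → ℕ), V.sbst (fun n => .var (r n)) = V.rename r
  | .var n, r => rfl
  | .const f Vs, r => by
      simp only [Val.sbst, Val.rename, fun i => Val.sbst_var (Vs i)]
  | .unit, _ => rfl
  | .pair V W, r => by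
      simp only [Val.sbst, Val.rename, Val.sbst_var V, Val.sbst_var W]
  | .fn X M, r => by
      simp only [Val.sbst, Val.rename, Cmp.sbst_var M, liftSub_var]
  | .box τ V, r => by simp only [Val.sbst, Val.rename, Val.sbst_var V]
theorem Cmp.sbst_var {S : Signature.{u}} :
    ∀ (M : Cmp S) (r : ℕ → ℕ), M.sbst (fun n => .var (r n)) = M.rename r
  | .ret V, r => by simp only [Cmp.sbst, Cmp.rename, Val.sbst_var V]
  | .letIn M N, r => by
      simp only [Cmp.sbst, Cmp.rename, Cmp.sbst_var M, Cmp.sbst_var N, liftSub_var]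
  | .app V W, r => by
      simp only [Cmp.sbst, Cmp.rename, Val.sbst_var V, Val.sbst_var W]
  | .matchPair V N, r => by
      simp only [Cmp.sbst, Cmp.rename, Val.sbst_var V, Cmp.sbst_var N, liftSub_var]
  | .op o V M, r => by
      simp only [Cmp.sbst, Cmp.rename, Val.sbst_var V, Cmp.sbst_var M, liftSub_var]
  | .delay τ M, r => by simp only [Cmp.sbst, Cmp.rename, Cmp.sbst_var M]
  | .handle M H N, r => by
      simp only [Cmp.sbst, Cmp.rename, Cmp.sbst_var M, Cmp.sbst_var N,
        fun o => Cmp.sbst_var (H o), liftSub_var]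
  | .unbox τ V N, r => by
      simp only [Cmp.sbst, Cmp.rename, Val.sbst_var V, Cmp.sbst_var N, liftSub_var]
end

theorem liftSub_comp_liftRen {S : Signature.{u}} (σ : ℕ → Val S) (r : ℕ → ℕ) :
    liftSub σ ∘ liftRen r = liftSub (σ ∘ r) := by
  funext n; cases n <;> rfl

mutual
theorem Val.sbst_rename {S : Signature.{u}} :
    ∀ (V : Val S) (r : ℕ → ℕ) (σ : ℕ → Val S), (V.rename r).sbst σ = V.sbst (σ ∘ r)
  | .var n, r, σ => rfl
  | .const f Vs, r, σ => by
      simp only [Val.sbst, Val.rename, fun i => Val.sbst_rename (Vs i)]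
  | .unit, _, _ => rfl
  | .pair V W, r, σ => by
      simp only [Val.sbst, Val.rename, Val.sbst_rename V, Val.sbst_rename W]
  | .fn X M, r, σ => by
      simp only [Val.sbst, Val.rename, Cmp.sbst_rename M, liftSub_comp_liftRen]
  | .box τ V, r, σ => by simp only [Val.sbst, Val.rename, Val.sbst_rename V]
theorem Cmp.sbst_rename {S : Signature.{u}} :
    ∀ (M : Cmp S) (r : ℕ → ℕ) (σ : ℕ → Val S), (M.rename r).sbst σ = M.sbst (σ ∘ r)
  | .ret V, r, σ => by simp only [Cmp.sbst, Cmp.rename, Val.sbst_rename V]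
  | .letIn M N, r, σ => by
      simp only [Cmp.sbst, Cmp.rename, Cmp.sbst_rename M, Cmp.sbst_rename N,
        liftSub_comp_liftRen]
  | .app V W, r, σ => by
      simp only [Cmp.sbst, Cmp.rename, Val.sbst_rename V, Val.sbst_rename W]
  | .matchPair V N, r, σ => by
      simp only [Cmp.sbst, Cmp.rename, Val.sbst_rename V, Cmp.sbst_rename N,
        liftSub_comp_liftRen]
  | .op o V M, r, σ => by
      simp only [Cmp.sbst, Cmp.rename, Val.sbst_rename V, Cmp.sbst_rename M,
        liftSub_comp_liftRen]
  | .delay τ M, r, σ => by simp only [Cmp.sbst, Cmp.rename, Cmp.sbst_rename M]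
  | .handle M H N, r, σ => by
      simp only [Cmp.sbst, Cmp.rename, Cmp.sbst_rename M, Cmp.sbst_rename N,
        fun o => Cmp.sbst_rename (H o), liftSub_comp_liftRen]
  | .unbox τ V N, r, σ => by
      simp only [Cmp.sbst, Cmp.rename, Val.sbst_rename V, Cmp.sbst_rename N,
        liftSub_comp_liftRen]
end

theorem rename_liftSub {S : Signature.{u}} (σ : ℕ → Val S) (r : ℕ → ℕ) :
    (fun n => (liftSub σ n).rename (liftRen r)) = liftSub (fun n => (σ n).rename r) := by
  funext n
  cases n with
  | zero => rfl
  | succ n =>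
    simp only [liftSub, Val.shift_eq_rename, Val.rename_rename, shiftRen_zero]
    rfl

mutual
theorem Val.rename_sbst {S : Signature.{u}} : ∀ (V : Val S) (σ : ℕ → Val S) (r : ℕ → ℕ),
    (V.sbst σ).rename r = V.sbst (fun n => (σ n).rename r)
  | .var n, σ, r => rfl
  | .const f Vs, σ, r => by
      simp only [Val.sbst, Val.rename, fun i => Val.rename_sbst (Vs i)]
  | .unit, _, _ => rfl
  | .pair V W, σ, r => by
      simp only [Val.sbst, Val.rename, Val.rename_sbst V, Val.rename_sbst W]
  | .fn X M, σ, r => by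
      simp only [Val.sbst, Val.rename, Cmp.rename_sbst M, rename_liftSub]
  | .box τ V, σ, r => by simp only [Val.sbst, Val.rename, Val.rename_sbst V]
theorem Cmp.rename_sbst {S : Signature.{u}} : ∀ (M : Cmp S) (σ : ℕ → Val S) (r : ℕ → ℕ),
    (M.sbst σ).rename r = M.sbst (fun n => (σ n).rename r)
  | .ret V, σ, r => by simp only [Cmp.sbst, Cmp.rename, Val.rename_sbst V]
  | .letIn M N, σ, r => by
      simp only [Cmp.sbst, Cmp.rename, Cmp.rename_sbst M, Cmp.rename_sbst N, rename_liftSub]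
  | .app V W, σ, r => by
      simp only [Cmp.sbst, Cmp.rename, Val.rename_sbst V, Val.rename_sbst W]
  | .matchPair V N, σ, r => by
      simp only [Cmp.sbst, Cmp.rename, Val.rename_sbst V, Cmp.rename_sbst N, rename_liftSub]
  | .op o V M, σ, r => by
      simp only [Cmp.sbst, Cmp.rename, Val.rename_sbst V, Cmp.rename_sbst M, rename_liftSub]
  | .delay τ M, σ, r => by simp only [Cmp.sbst, Cmp.rename, Cmp.rename_sbst M]
  | .handle M H N, σ, r => by
      simp only [Cmp.sbst, Cmp.rename, Cmp.rename_sbst M, Cmp.rename_sbst N,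
        fun o => Cmp.rename_sbst (H o), rename_liftSub]
  | .unbox τ V N, σ, r => by
      simp only [Cmp.sbst, Cmp.rename, Val.rename_sbst V, Cmp.rename_sbst N, rename_liftSub]
end

/-- Serves the side condition of `unbox`: if `σ` restricts to `σ'` on the variables of the earlier
context, substituting into a shifted value gives again a shifted value. -/
theorem Val.sbst_shift_comm {S : Signature.{u}} (V : Val S) {σ σ' : ℕ → Val S} {k k' : ℕ}
    (h : ∀ n, σ (n + k) = (σ' n).shift k' 0) :
    (V.shift k 0).sbst σ = (V.sbst σ').shift k' 0 := by
  rw [Val.shift_eq_rename, Val.shift_eq_rename, Val.sbst_rename, Val.rename_sbst, shiftRen_zero]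
  congr 1
  funext n
  simp [h, Val.shift_eq_rename]

theorem Val.sbst_var_add {S : Signature.{u}} (V : Val S) (k : ℕ) :
    V.sbst (fun n => .var (n + k)) = V.shift k 0 := by
  rw [Val.sbst_var V (fun n => n + k), Val.shift_eq_rename, shiftRen_zero]

/-- The substitution of `W` for the variable with index `j`. -/
def instSub {S : Signature.{u}} (W : Val S) (j n : ℕ) : Val S :=
  if n < j then .var n else if n = j then W.shift j 0 else .var (n - 1)

theorem liftSub_instSub {S : Signature.{u}} (W : Val S) (j : ℕ) :
    liftSub (instSub W j) = instSub W (j + 1) := by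
  funext n
  cases n with
  | zero => simp [liftSub, instSub]
  | succ n =>
    simp only [liftSub, instSub, Nat.add_lt_add_iff_right, Nat.add_right_cancel_iff]
    split_ifs with h h'
    · simp [Val.shift]
    · rw [Val.shift_shift]
    · simp only [Val.shift, Nat.not_lt_zero, if_false]
      -- Here `n > j`, so `n` is positive and the truncated subtraction `n - 1` is exact.
      congr 1; omega

mutual
theorem Val.subst_eq_sbst {S : Signature.{u}} :
    ∀ (V W : Val S) (j : ℕ), V.subst W j = V.sbst (instSub W j)
  | .var n, W, j => rfl
  | .const f Vs, W, j => by
      simp only [Val.subst, Val.sbst, fun i => Val.subst_eq_sbst (Vs i)]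
  | .unit, _, _ => rfl
  | .pair V V', W, j => by
      simp only [Val.subst, Val.sbst, Val.subst_eq_sbst V, Val.subst_eq_sbst V']
  | .fn X M, W, j => by
      simp only [Val.subst, Val.sbst, Cmp.subst_eq_sbst M, liftSub_instSub]
  | .box τ V, W, j => by simp only [Val.subst, Val.sbst, Val.subst_eq_sbst V]
theorem Cmp.subst_eq_sbst {S : Signature.{u}} :
    ∀ (M : Cmp S) (W : Val S) (j : ℕ), M.subst W j = M.sbst (instSub W j)
  | .ret V, W, j => by simp only [Cmp.subst, Cmp.sbst, Val.subst_eq_sbst V]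
  | .letIn M N, W, j => by
      simp only [Cmp.subst, Cmp.sbst, Cmp.subst_eq_sbst M, Cmp.subst_eq_sbst N,
        liftSub_instSub]
  | .app V V', W, j => by
      simp only [Cmp.subst, Cmp.sbst, Val.subst_eq_sbst V, Val.subst_eq_sbst V']
  | .matchPair V N, W, j => by
      simp only [Cmp.subst, Cmp.sbst, Val.subst_eq_sbst V, Cmp.subst_eq_sbst N,
        liftSub_instSub]
  | .op o V M, W, j => by
      simp only [Cmp.subst, Cmp.sbst, Val.subst_eq_sbst V, Cmp.subst_eq_sbst M,
        liftSub_instSub]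
  | .delay τ M, W, j => by simp only [Cmp.subst, Cmp.sbst, Cmp.subst_eq_sbst M]
  | .handle M H N, W, j => by
      simp only [Cmp.subst, Cmp.sbst, Cmp.subst_eq_sbst M, Cmp.subst_eq_sbst N,
        fun o => Cmp.subst_eq_sbst (H o), liftSub_instSub]
  | .unbox τ V N, W, j => by
      simp only [Cmp.subst, Cmp.sbst, Val.subst_eq_sbst V, Cmp.subst_eq_sbst N,
        liftSub_instSub]
end

/-! # Contexts and uniqueness of derivations -/

namespace Ctx

variable {Base : Type u}

@[simp] theorem minus_zero (Γ : Ctx Base) : Γ.minus 0 = Γ := by cases Γ <;> rfl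

theorem len_minus_le : ∀ (Γ : Ctx Base) (t : ℕ), (Γ.minus t).len ≤ Γ.len
  | Γ, 0 => by simp
  | nil, t + 1 => le_rfl
  | var Γ _, t + 1 => (len_minus_le Γ (t + 1)).trans (Nat.le_succ _)
  | mod Γ τ', t + 1 => by
      by_cases h : t + 1 ≤ τ'
      · rw [minus_mod_of_le Γ h]; exact le_rfl
      · rw [minus_mod_of_not_le Γ h]; exact len_minus_le Γ _

theorem minus_var (Γ : Ctx Base) (X : VTy Base) {t : ℕ} (ht : t ≠ 0) :
    (Γ.var X).minus t = Γ.minus t := by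
  cases t with
  | zero => exact absurd rfl ht
  | succ t => rfl

/-- This and `minus_mod_of_add` restate the two branches of the definition by addition, which
removes truncated subtraction from the later case distinctions. -/
theorem minus_mod_add (Γ : Ctx Base) {t u τ : ℕ} (h : t + u = τ) :
    (Γ.mod τ).minus t = Γ.mod u := by
  subst h
  cases t with
  | zero => simp
  | succ t => rw [minus_mod_of_le Γ (by omega)]; congr 1; omega

/-- The condition `u ≠ 0` matters: cutting `Γ, ⟨τ⟩` by exactly `τ` leaves `Γ, ⟨0⟩` and not `Γ`. -/
theorem minus_mod_of_add (Γ : Ctx Base) {t u τ : ℕ} (h : t = τ + u) (hu : u ≠ 0) :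
    (Γ.mod τ).minus t = Γ.minus u := by
  subst h
  obtain ⟨t, ht⟩ : ∃ t, τ + u = t + 1 := ⟨τ + u - 1, by omega⟩
  rw [ht, minus_mod_of_not_le Γ (by omega), ← ht]
  congr 1; omega

theorem time_minus : ∀ (Γ : Ctx Base) (t : ℕ), t ≤ Γ.time → (Γ.minus t).time + t = Γ.time
  | Γ, 0, _ => by simp
  | nil, t + 1, h => absurd h (Nat.not_succ_le_zero t)
  | var Γ _, t + 1, h => time_minus Γ (t + 1) h
  | mod Γ τ', t + 1, h => by
      have h0 : t + 1 ≤ Γ.time + τ' := h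
      by_cases h' : t + 1 ≤ τ'
      · rw [minus_mod_of_le Γ h']; simp only [time]; omega
      · rw [minus_mod_of_not_le Γ h']
        have := time_minus Γ (t + 1 - τ') (by omega)
        simp only [time]; omega

theorem minus_minus : ∀ (Γ : Ctx Base) (s t : ℕ), (Γ.minus s).minus t = Γ.minus (s + t)
  | Γ, 0, t => by simp
  | Γ, s, 0 => by simp
  | nil, s + 1, t + 1 => rfl
  | var Γ _, s + 1, t + 1 => by
      rw [minus_var _ _ (by omega), minus_var _ _ (by omega)]; exact minus_minus Γ (s + 1) (t + 1)
  | mod Γ τ, s + 1, t + 1 => by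
      by_cases h' : s + 1 ≤ τ
      · rw [minus_mod_add Γ (Nat.add_sub_of_le h')]
        by_cases h : s + 1 + (t + 1) ≤ τ
        · rw [minus_mod_add Γ (u := τ - (s + 1 + (t + 1))) (by omega),
            minus_mod_add Γ (u := τ - (s + 1 + (t + 1))) (by omega)]
        · rw [minus_mod_of_add Γ (u := s + 1 + (t + 1) - τ) (by omega) (by omega),
            minus_mod_of_add Γ (u := s + 1 + (t + 1) - τ) (by omega) (by omega)]
      · rw [minus_mod_of_add Γ (u := s + 1 - τ) (by omega) (by omega), minus_minus,
          minus_mod_of_add Γ (u := s + 1 - τ + (t + 1)) (by omega) (by omega)]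

/-- Counting variables from the right pins down one variable of the context, and the context splits
there in only one way, whatever modalities surround it. This makes the variable rule deterministic.
-/
theorem append_var_inj {Γ₁ Γ₂ : Ctx Base} {X₁ X₂ : VTy Base} : ∀ {Δ₁ Δ₂ : Ctx Base},
    (Γ₁.var X₁).append Δ₁ = (Γ₂.var X₂).append Δ₂ → Δ₁.len = Δ₂.len →
    Γ₁ = Γ₂ ∧ X₁ = X₂ ∧ Δ₁ = Δ₂ := by
  intro Δ₁
  induction Δ₁ with
  | nil => intro Δ₂; cases Δ₂ <;> simp [append, len]
  | var Δ₁ Y ih =>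
    intro Δ₂
    cases Δ₂ <;> simp [append, len]
    intro h hY hl
    obtain ⟨a, b, c⟩ := ih h hl
    exact ⟨a, b, c, hY⟩
  | mod Δ₁ Y ih =>
    intro Δ₂
    cases Δ₂ <;> simp [append, len]
    intro h hY hl
    obtain ⟨a, b, c⟩ := ih h hl
    exact ⟨a, b, c, hY⟩

end Ctx

-- The rules are syntax-directed, and the types of bound variables are fixed by an annotation, by
-- the signature or by the type of an earlier premise. In `handle`, the result type `Y` that the
-- clauses mention is fixed by the continuation `N`. So the type, the grade and the derivation are
-- all determined by the context and the term.
mutual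
theorem VTyping.unique {S : Signature.{u}} {Γ : Ctx S.Base} : ∀ {V : Val S} {X X' : VTy S.Base}
    (d : VTyping S Γ V X) (d' : VTyping S Γ V X'), X = X' ∧ d ≍ d'
  | _, _, _, .var Γ₁ Γ₂ hΔ hn, .var Γ₁' Γ₂' hΔ' hn' => by
      obtain ⟨rfl, rfl, rfl⟩ := Ctx.append_var_inj (hΔ.symm.trans hΔ') (hn.symm.trans hn')
      exact ⟨rfl, HEq.rfl⟩
  | _, _, _, .const f dVs, .const _ dVs' => by
      have h : dVs = dVs' := funext fun i => eq_of_heq (VTyping.unique (dVs i) (dVs' i)).2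
      subst h; exact ⟨rfl, HEq.rfl⟩
  | _, _, _, .unit, .unit => ⟨rfl, HEq.rfl⟩
  | _, _, _, .pair dV dW, .pair dV' dW' => by
      obtain ⟨rfl, h⟩ := VTyping.unique dV dV'
      obtain ⟨rfl, h'⟩ := VTyping.unique dW dW'
      cases h; cases h'; exact ⟨rfl, HEq.rfl⟩
  | _, _, _, .fn dM, .fn dM' => by
      obtain ⟨rfl, rfl, h⟩ := CTyping.unique dM dM'
      cases h; exact ⟨rfl, HEq.rfl⟩
  | _, _, _, .box dV, .box dV' => by
      obtain ⟨rfl, h⟩ := VTyping.unique dV dV'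
      cases h; exact ⟨rfl, HEq.rfl⟩
theorem CTyping.unique {S : Signature.{u}} {Γ : Ctx S.Base} : ∀ {M : Cmp S} {X X' : VTy S.Base}
    {τ τ' : ℕ} (d : CTyping S Γ M X τ) (d' : CTyping S Γ M X' τ'), X = X' ∧ τ = τ' ∧ d ≍ d'
  | _, _, _, _, _, .ret dV, .ret dV' => by
      obtain ⟨rfl, h⟩ := VTyping.unique dV dV'
      cases h; exact ⟨rfl, rfl, HEq.rfl⟩
  | _, _, _, _, _, .letIn dM dN, .letIn dM' dN' => by
      obtain ⟨rfl, rfl, h⟩ := CTyping.unique dM dM'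
      obtain ⟨rfl, rfl, h'⟩ := CTyping.unique dN dN'
      cases h; cases h'; exact ⟨rfl, rfl, HEq.rfl⟩
  | _, _, _, _, _, .app dV dW, .app dV' dW' => by
      obtain ⟨h1, h⟩ := VTyping.unique dV dV'
      cases h1
      obtain ⟨-, h'⟩ := VTyping.unique dW dW'
      cases h; cases h'; exact ⟨rfl, rfl, HEq.rfl⟩
  | _, _, _, _, _, .matchPair dV dN, .matchPair dV' dN' => by
      obtain ⟨h1, h⟩ := VTyping.unique dV dV'
      cases h1
      obtain ⟨rfl, rfl, h'⟩ := CTyping.unique dN dN'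
      cases h; cases h'; exact ⟨rfl, rfl, HEq.rfl⟩
  | _, _, _, _, _, .op o dV dM, .op _ dV' dM' => by
      obtain ⟨-, h⟩ := VTyping.unique dV dV'
      obtain ⟨rfl, rfl, h'⟩ := CTyping.unique dM dM'
      cases h; cases h'; exact ⟨rfl, rfl, HEq.rfl⟩
  | _, _, _, _, _, .delay dM, .delay dM' => by
      obtain ⟨rfl, rfl, h⟩ := CTyping.unique dM dM'
      cases h; exact ⟨rfl, rfl, HEq.rfl⟩
  | _, _, _, _, _, .handle dM dN dH, .handle dM' dN' dH' => by
      obtain ⟨rfl, rfl, h⟩ := CTyping.unique dM dM'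
      obtain ⟨rfl, rfl, h'⟩ := CTyping.unique dN dN'
      have h'' : dH = dH' :=
        funext fun o => funext fun τ => eq_of_heq (CTyping.unique (dH o τ) (dH' o τ)).2.2
      cases h; cases h'; cases h''; exact ⟨rfl, rfl, HEq.rfl⟩
  | _, _, _, _, _, .unbox hτ hV dV dN, .unbox hτ' hV' dV' dN' => by
      obtain rfl := Val.shift_injective (hV.symm.trans hV')
      obtain ⟨h1, h⟩ := VTyping.unique dV dV'
      cases h1
      obtain ⟨rfl, rfl, h'⟩ := CTyping.unique dN dN'
      cases h; cases h'; exact ⟨rfl, rfl, HEq.rfl⟩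
end

/-! # Coherence of the context modality -/

namespace PastModality

variable {C : Type v} [Category.{w} C] (P : PastModality C)

theorem le_refl_app {τ : ℕ} (h : τ ≤ τ) (A : C) : (P.le h).app A = 𝟙 _ := by
  have : (homOfLE h).op = 𝟙 (op τ) := Subsingleton.elim _ _
  rw [PastModality.le, this]
  simp

theorem le_le_app {a b c : ℕ} (h : b ≤ a) (h' : c ≤ b) (A : C) :
    (P.le h).app A ≫ (P.le h').app A = (P.le (h'.trans h)).app A := by
  rw [← NatTrans.comp_app, ← Functor.map_comp]
  rfl

theorem counit_η (τ : ℕ) (A : C) :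
    (P.counit τ).app A ≫ P.η.hom.app A = (P.le (Nat.zero_le τ)).app A := by
  simp [counit]

theorem le_counit {a b : ℕ} (h : a ≤ b) (A : C) :
    (P.le h).app A ≫ (P.counit a).app A = (P.counit b).app A := by
  simp only [counit, NatTrans.comp_app]
  rw [reassoc_of% P.le_le_app h (Nat.zero_le a) A]

theorem η_counit (A : C) : P.η.hom.app A ≫ (P.counit 0).app A = 𝟙 _ := by
  simp only [counit, NatTrans.comp_app]
  rw [le_refl_app]
  simp

/-- Composition of morphisms into modal objects, as in the Kleisli category of a graded monad. -/
def bind {A B D : C} {a b c : ℕ} (p : A ⟶ (P.at a).obj B) (q : B ⟶ (P.at b).obj D)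
    (h : c ≤ a + b) : A ⟶ (P.at c).obj D :=
  p ≫ (P.at a).map q ≫ (P.μ a b).hom.app D ≫ (P.le h).app D

variable {P}

theorem comp_bind {A A' B D : C} {a b c : ℕ} (f : A' ⟶ A) (p : A ⟶ (P.at a).obj B)
    (q : B ⟶ (P.at b).obj D) (h : c ≤ a + b) : P.bind (f ≫ p) q h = f ≫ P.bind p q h := by
  simp [bind]

theorem map_bind {A B B' D : C} {a b c : ℕ} (p : A ⟶ (P.at a).obj B) (f : B ⟶ B')
    (q : B' ⟶ (P.at b).obj D) (h : c ≤ a + b) :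
    P.bind (p ≫ (P.at a).map f) q h = P.bind p (f ≫ q) h := by
  simp [bind]

theorem bind_map {A B D D' : C} {a b c : ℕ} (p : A ⟶ (P.at a).obj B)
    (q : B ⟶ (P.at b).obj D) (f : D ⟶ D') (h : c ≤ a + b) :
    P.bind p (q ≫ (P.at b).map f) h = P.bind p q h ≫ (P.at c).map f := by
  have h1 := (P.μ a b).hom.naturality f
  simp only [Functor.comp_map] at h1
  simp only [bind, Functor.map_comp, Category.assoc]
  rw [reassoc_of% h1, (P.le h).naturality]

/-- The inequality built into `bind` absorbs coercions `P.le` applied to the result (here) or to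
either argument (`le_bind`, `bind_comp_le`). Equations between composites can then be proved without
transport along equalities of grades. -/
theorem bind_le {A B D : C} {a b c d : ℕ} (p : A ⟶ (P.at a).obj B) (q : B ⟶ (P.at b).obj D)
    (h : c ≤ a + b) (h' : d ≤ c) :
    P.bind p q h ≫ (P.le h').app D = P.bind p q (h'.trans h) := by
  simp only [bind, Category.assoc, le_le_app]

theorem le_bind {A B D : C} {a b c d : ℕ} (p : A ⟶ (P.at a).obj B) (q : B ⟶ (P.at b).obj D)
    (h : c ≤ d + b) (h' : d ≤ a) :
    P.bind (p ≫ (P.le h').app B) q h = P.bind p q (h.trans (Nat.add_le_add_right h' b)) := by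
  have h1 := P.μ_monotone h' (le_refl b) D
  have h2 := (P.le h').naturality q
  have h3 : (P.F.map (homOfLE (le_refl b)).op).app D = 𝟙 _ := P.le_refl_app _ D
  rw [h3, CategoryTheory.Functor.map_id, Category.id_comp] at h1
  simp only [bind, Category.assoc]
  rw [← reassoc_of% h2, ← reassoc_of% h1, le_le_app]

theorem bind_comp_le {A B D : C} {a b c d : ℕ} (p : A ⟶ (P.at a).obj B)
    (q : B ⟶ (P.at b).obj D) (h : c ≤ a + d) (h' : d ≤ b) :
    P.bind p (q ≫ (P.le h').app D) h = P.bind p q (h.trans (Nat.add_le_add_left h' a)) := by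
  have h1 := P.μ_monotone (le_refl a) h' D
  have h3 : (P.F.map (homOfLE (le_refl a)).op).app ((P.at b).obj D) = 𝟙 _ := P.le_refl_app _ _
  rw [h3, Category.id_comp] at h1
  simp only [bind, Category.assoc, Functor.map_comp]
  rw [← reassoc_of% h1, le_le_app]

theorem η_bind {A D : C} {b c : ℕ} (q : A ⟶ (P.at b).obj D) (h : c ≤ 0 + b) :
    P.bind (P.η.hom.app A) q h = q ≫ (P.le (h.trans (Nat.zero_add b).le)).app D := by
  have h1 := P.η_μ b D
  have h2 := P.η.hom.naturality q
  simp only [Functor.id_map] at h2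
  simp only [bind]
  rw [← reassoc_of% h2, reassoc_of% h1, le_le_app]

theorem bind_η {A D : C} {a c : ℕ} (p : A ⟶ (P.at a).obj D) (h : c ≤ a + 0) :
    P.bind p (P.η.hom.app D) h = p ≫ (P.le (h.trans (Nat.add_zero a).le)).app D := by
  have h1 := P.map_η_μ a D
  simp only [bind]
  rw [reassoc_of% h1, le_le_app]

theorem bind_assoc {A B D E : C} {a b c x y z : ℕ} (p : A ⟶ (P.at a).obj B)
    (q : B ⟶ (P.at b).obj D) (r : D ⟶ (P.at c).obj E) (hx : x ≤ a + b) (hy : y ≤ x + c)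
    (hz : z ≤ b + c) (hy' : y ≤ a + z) :
    P.bind (P.bind p q hx) r hy = P.bind p (P.bind q r hz) hy' := by
  -- All slack in the grades is pulled out and absorbed, which leaves associativity of `μ` at exact
  -- grades.
  have e1 : P.bind p q hx = P.bind p q le_rfl ≫ (P.le hx).app D := (bind_le p q le_rfl hx).symm
  have e2 : P.bind q r hz = P.bind q r le_rfl ≫ (P.le hz).app E := (bind_le q r le_rfl hz).symm
  rw [e1, e2, le_bind, bind_comp_le]
  have h1 := P.μ_assoc a b c E
  have h2 := (P.μ a b).hom.naturality r
  simp only [Functor.comp_map] at h2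
  simp only [bind, le_refl_app, Category.comp_id, Functor.map_comp, Category.assoc]
  rw [← reassoc_of% h2, ← reassoc_of% h1, le_le_app]

theorem comp_counit_η {A B : C} {a : ℕ} (p : A ⟶ (P.at a).obj B) :
    (p ≫ (P.counit a).app B : A ⟶ B) ≫ P.η.hom.app B = p ≫ (P.le (Nat.zero_le a)).app B :=
  (Category.assoc _ _ _).trans (congrArg (p ≫ ·) (P.counit_η a B))

/-- Following the counit by `η` coerces `p` to grade `0`, and binding after `η` is composition up to
coercion. Discarding time thereby becomes an instance of `bind`, so that the laws of `bind` apply to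
it. -/
theorem comp_counit_comp {A B D : C} {a b : ℕ} (p : A ⟶ (P.at a).obj B)
    (q : B ⟶ (P.at b).obj D) :
    p ≫ (P.counit a).app B ≫ q = P.bind p q (Nat.le_add_left b a) := by
  have h1 := comp_bind (p ≫ (P.counit a).app B : A ⟶ B) (P.η.hom.app B) q (Nat.zero_add b).ge
  rw [comp_counit_η, η_bind, le_bind, le_refl_app, Category.comp_id] at h1
  exact (h1.trans (Category.assoc _ _ _)).symm

theorem comp_map_counit {A B D : C} {a b : ℕ} (p : A ⟶ (P.at a).obj B)
    (q : B ⟶ (P.at b).obj D) :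
    p ≫ (P.at a).map (q ≫ (P.counit b).app D) = P.bind p q (Nat.le_add_right a b) := by
  have h1 := map_bind p (q ≫ (P.counit b).app D : B ⟶ D) (P.η.hom.app D) (Nat.add_zero a).ge
  rw [comp_counit_η, bind_η, bind_comp_le, le_refl_app, Category.comp_id] at h1
  exact h1

/-- Both sides are the exact composite at grade `a + b` followed by the counit: collapsing two
modalities and discarding the sum is discarding them one after the other. -/
theorem bind_counit {A B D : C} {a b c : ℕ} (p : A ⟶ (P.at a).obj B)
    (q : B ⟶ (P.at b).obj D) (h : c ≤ a + b) :
    P.bind p q h ≫ (P.counit c).app D = p ≫ (P.counit a).app B ≫ q ≫ (P.counit b).app D := by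
  have h1 := congrArg (· ≫ (P.counit b).app D) (comp_counit_comp p q)
  simp only [Category.assoc] at h1
  refine Eq.trans ?_ h1.symm
  rw [← bind_le p q le_rfl h, ← bind_le p q le_rfl (Nat.le_add_left b a), Category.assoc,
    Category.assoc, le_counit, le_counit]

/-- Holds since `μ` and the image of `i` are invertible. It allows maps into `⟨t⟩ ⟦Γ, ⟨r⟩⟧` to be
compared after merging the two modalities, where the inverse of `μ` in `ηPRA` disappears. -/
theorem bind_iso_injective {A B D : C} {a b : ℕ} {p q : A ⟶ (P.at a).obj D}
    (i : D ⟶ (P.at b).obj B) [IsIso i]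
    (h : P.bind p i (le_refl (a + b)) = P.bind q i (le_refl (a + b))) : p = q := by
  simp only [bind, le_refl_app, Category.comp_id] at h
  exact (cancel_mono ((P.at a).map i ≫ (P.μ a b).hom.app B)).1 h

end PastModality

-- Going back in time along a context

namespace TypeModel

variable {S : Signature.{u}} {C : Type v} [Category.{w} C]
  [CartesianMonoidalCategory C] [MonoidalClosed C] (M : TypeModel S C)

/-- The transformation `ηPRA`, up to an equality of contexts in its codomain. -/
def toPast {Γ Γ₀ : Ctx S.Base} {τ : ℕ} (hτ : τ ≤ Γ.time) (h : Γ.minus τ = Γ₀) (A : C) :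
    (M.ctx Γ).obj A ⟶ (M.past.at τ).obj ((M.ctx Γ₀).obj A) :=
  M.ηPRA Γ τ hτ A ≫ eqToHom (congrArg (fun Δ => (M.past.at τ).obj ((M.ctx Δ).obj A)) h)

theorem toPast_rfl {Γ : Ctx S.Base} {τ : ℕ} (hτ : τ ≤ Γ.time) (A : C) :
    M.toPast hτ rfl A = M.ηPRA Γ τ hτ A := by
  simp [toPast]

theorem toPast_zero {Γ : Ctx S.Base} (h : 0 ≤ Γ.time) (h' : Γ.minus 0 = Γ) (A : C) :
    M.toPast h h' A = M.past.η.hom.app ((M.ctx Γ).obj A) := by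
  cases Γ <;> exact Category.comp_id _

/-- The projection `⟦Γ, x : X⟧ A ⟶ ⟦Γ⟧ A`. -/
def wkVar (Γ : Ctx S.Base) (X : VTy S.Base) (A : C) :
    (M.ctx (Γ.var X)).obj A ⟶ (M.ctx Γ).obj A :=
  fst ((M.ctx Γ).obj A) (M.ty X)

/-- The identity `⟦Γ, ⟨τ⟩⟧ A = ⟨τ⟩ (⟦Γ⟧ A)`, as a morphism. -/
def openMod (Γ : Ctx S.Base) (τ : ℕ) (A : C) :
    (M.ctx (Γ.mod τ)).obj A ⟶ (M.past.at τ).obj ((M.ctx Γ).obj A) :=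
  𝟙 ((M.past.at τ).obj ((M.ctx Γ).obj A))

theorem toPast_var {Γ Γ₀ : Ctx S.Base} {X : VTy S.Base} {τ : ℕ} (h0 : τ ≠ 0)
    (hτ : τ ≤ (Γ.var X).time) (h : (Γ.var X).minus τ = Γ₀) (hτ' : τ ≤ Γ.time)
    (h' : Γ.minus τ = Γ₀) (A : C) :
    M.toPast hτ h A = M.wkVar Γ X A ≫ M.toPast hτ' h' A := by
  cases τ with
  | zero => exact absurd rfl h0
  | succ t => exact Category.assoc _ _ _

theorem toPast_mod_add {Γ : Ctx S.Base} {τ t r : ℕ} (e : t + r = τ)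
    (hτ : t ≤ (Γ.mod τ).time) (h : (Γ.mod τ).minus t = Γ.mod r) (A : C) :
    M.toPast hτ h A ≫ (M.past.μ t r).hom.app ((M.ctx Γ).obj A)
      = (M.past.le e.le).app ((M.ctx Γ).obj A) := by
  subst e
  cases t with
  | zero =>
    -- The grade `0 + r` is generalised to `u`, so that it can be identified with `r`.
    have key : ∀ (u : ℕ) (hu : 0 + r = u) (h0 : 0 ≤ (Γ.mod u).time)
        (h : (Γ.mod u).minus 0 = Γ.mod r),
        M.toPast h0 h A ≫ (M.past.μ 0 r).hom.app ((M.ctx Γ).obj A)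
          = (M.past.le hu.le).app ((M.ctx Γ).obj A) := by
      intro u hu h0 h
      obtain rfl : u = r := by omega
      rw [toPast_zero]
      exact M.past.η_μ u ((M.ctx Γ).obj A)
    exact key _ rfl _ _
  | succ t =>
    -- The remainder in `ηPRA` is literally `t + 1 + r - (t + 1)`; it is generalised to `u` and then
    -- specialised to `r`.
    have key : ∀ (u : ℕ) (hu : t + 1 + r - (t + 1) = u)
        (h : (Γ.mod (t + 1 + r)).minus (t + 1) = Γ.mod u) (hle : t + 1 + u ≤ t + 1 + r),
        M.toPast hτ h A ≫ (M.past.μ (t + 1) u).hom.app ((M.ctx Γ).obj A)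
          = (M.past.le hle).app ((M.ctx Γ).obj A) := by
      rintro u rfl h hle
      have h1 : t + 1 ≤ t + 1 + r := by omega
      have aux : ∀ {a b c d : C} (f : a ⟶ b) (i : c ≅ b) (p : c = d) (q : d = c),
          ((f ≫ i.inv ≫ eqToHom p) ≫ eqToHom q) ≫ i.hom = f := by
        rintro a b c d f i rfl q; simp
      simp only [toPast, ηPRA, dif_pos h1]
      exact aux _ ((M.past.μ (t + 1) _).app _) _ _
    exact key r (by omega) h le_rfl

theorem toPast_mod_of_add {Γ Γ₀ : Ctx S.Base} {τ t r : ℕ} (e : t = τ + r) (h0 : r ≠ 0)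
    (hτ : t ≤ (Γ.mod τ).time) (h : (Γ.mod τ).minus t = Γ₀) (hτ' : r ≤ Γ.time)
    (h' : Γ.minus r = Γ₀) (A : C) :
    M.toPast hτ h A = M.past.bind (M.openMod Γ τ A) (M.toPast hτ' h' A) e.le := by
  cases t with
  | zero => omega
  | succ t =>
    obtain rfl : r = t + 1 - τ := by omega
    subst h'
    have h1 : ¬ t + 1 ≤ τ := by omega
    have aux : ∀ {a b c d e : C} (f : a ⟶ b) (g : b ⟶ c) (k : c ⟶ d) (p : d = e) (q : e = d),
        (f ≫ g ≫ k ≫ eqToHom p) ≫ eqToHom q = 𝟙 _ ≫ f ≫ g ≫ k := by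
      rintro a b c d e f g k rfl q; simp
    simp only [toPast, ηPRA, dif_neg h1, PastModality.bind, eqToHom_refl, Category.comp_id]
    exact aux _ _ _ _ _

end TypeModel

open PastModality

namespace TypeModel

variable {S : Signature.{u}} {C : Type v} [Category.{w} C]
  [CartesianMonoidalCategory C] [MonoidalClosed C] (M : TypeModel S C)

instance (Γ : Ctx S.Base) (τ : ℕ) (A : C) : IsIso (M.openMod Γ τ A) :=
  inferInstanceAs (IsIso (𝟙 ((M.past.at τ).obj ((M.ctx Γ).obj A))))

theorem toPast_mod_bind {Γ : Ctx S.Base} {τ t r c : ℕ} (e : t + r = τ)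
    (hτ : t ≤ (Γ.mod τ).time) (h : (Γ.mod τ).minus t = Γ.mod r) (A : C) (hc : c ≤ t + r) :
    M.past.bind (M.toPast hτ h A) (M.openMod Γ r A) hc
      = M.openMod Γ τ A ≫ (M.past.le (hc.trans e.le)).app ((M.ctx Γ).obj A) := by
  have aux : ∀ {D B : C} {a b : ℕ} (hb : b ≤ a) (hc : c ≤ t + r)
      (p : (M.past.at a).obj D ⟶ (M.past.at t).obj ((M.past.at r).obj B))
      (l : (M.past.at a).obj D ⟶ (M.past.at (t + r)).obj B),
      p ≫ (M.past.μ t r).hom.app B = l →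
      M.past.bind p (𝟙 _) hc = 𝟙 _ ≫ l ≫ (M.past.le hc).app B := by
    rintro D B a b hb hc p l rfl
    simp [PastModality.bind]
  rw [← le_le_app M.past e.le hc]
  exact aux e.le hc _ _ (M.toPast_mod_add e hτ h A)

/-- Coherence of going back in time. A zero cut is `η`, so the cases `s = 0` and `t = 0` are unit
laws. A trailing variable is projected away on both sides. For a trailing modality the position of
`s` and `u` relative to `τ` decides. -/
theorem toPast_bind (A : C) (Γ : Ctx S.Base) : ∀ {s t u : ℕ} {Γ₁ Γ₂ : Ctx S.Base}
    (hu : u = s + t) (hs : s ≤ Γ.time) (h₁ : Γ.minus s = Γ₁) (ht : t ≤ Γ₁.time)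
    (h₂ : Γ₁.minus t = Γ₂) (hu' : u ≤ Γ.time) (h₃ : Γ.minus u = Γ₂),
    M.past.bind (M.toPast hs h₁ A) (M.toPast ht h₂ A) hu.le = M.toPast hu' h₃ A := by
  induction Γ with
  | nil =>
    intro s t u Γ₁ Γ₂ hu hs h₁ ht h₂ hu' h₃
    obtain rfl : s = 0 := Nat.le_zero.1 hs
    obtain rfl : u = 0 := Nat.le_zero.1 hu'
    obtain rfl : t = 0 := by omega
    obtain rfl : Ctx.nil = Γ₁ := (Ctx.minus_zero _).symm.trans h₁
    obtain rfl : Ctx.nil = Γ₂ := (Ctx.minus_zero _).symm.trans h₂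
    rw [toPast_zero]
    exact (η_bind _ _).trans (by rw [le_refl_app]; exact Category.comp_id _)
  | var Γ X ih =>
    intro s t u Γ₁ Γ₂ hu hs h₁ ht h₂ hu' h₃
    rcases Nat.eq_zero_or_pos s with rfl | hs0
    · obtain rfl : Γ.var X = Γ₁ := (Ctx.minus_zero _).symm.trans h₁
      obtain rfl : u = t := by omega
      rw [toPast_zero, η_bind, le_refl_app]
      exact Category.comp_id _
    rcases Nat.eq_zero_or_pos t with rfl | ht0
    · obtain rfl : u = s := by omega
      obtain rfl : Γ₁ = Γ₂ := (Ctx.minus_zero _).symm.trans h₂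
      rw [M.toPast_zero ht, bind_η, le_refl_app]
      exact Category.comp_id _
    have hs' : s ≤ Γ.time := hs
    have hu'' : u ≤ Γ.time := hu'
    rw [M.toPast_var hs0.ne' hs h₁ hs' (by rwa [← Ctx.minus_var _ X hs0.ne']),
      M.toPast_var (by omega) hu' h₃ hu'' (by rwa [← Ctx.minus_var _ X (by omega)]), comp_bind,
      ih hu]
  | mod Γ τ ih =>
    intro s t u Γ₁ Γ₂ hu hs h₁ ht h₂ hu' h₃
    rcases Nat.eq_zero_or_pos s with rfl | hs0
    · obtain rfl : Γ.mod τ = Γ₁ := (Ctx.minus_zero _).symm.trans h₁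
      obtain rfl : u = t := by omega
      rw [toPast_zero, η_bind, le_refl_app]
      exact Category.comp_id _
    rcases Nat.eq_zero_or_pos t with rfl | ht0
    · obtain rfl : u = s := by omega
      obtain rfl : Γ₁ = Γ₂ := (Ctx.minus_zero _).symm.trans h₂
      rw [M.toPast_zero ht, bind_η, le_refl_app]
      exact Category.comp_id _
    have hu0 : u ≤ Γ.time + τ := hu'
    by_cases hsτ : s ≤ τ
    · obtain ⟨x, hx⟩ := Nat.exists_eq_add_of_le hsτ
      obtain rfl : Γ.mod x = Γ₁ := (Ctx.minus_mod_add Γ hx.symm).symm.trans h₁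
      -- Both cuts stay inside `⟨τ⟩`: once the leftover modality is opened, both sides are coercions
      -- of the opened `⟨τ⟩`.
      by_cases huτ : u ≤ τ
      · obtain ⟨y, hy⟩ := Nat.exists_eq_add_of_le huτ
        obtain rfl : Γ.mod y = Γ₂ := (Ctx.minus_mod_add Γ hy.symm).symm.trans h₃
        apply bind_iso_injective (M.openMod Γ y A)
        rw [bind_assoc _ _ _ hu.le le_rfl (z := x) (by omega) (by omega),
          M.toPast_mod_bind (by omega), M.toPast_mod_bind hy.symm, bind_comp_le,
          M.toPast_mod_bind hx.symm]
      -- The first cut stops inside `⟨τ⟩` and the second leaves it: by associativity the two pieces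
      -- of `⟨τ⟩` merge, and the rest of the second cut is common to both sides.
      · have h₃' : Γ.minus (u - τ) = Γ₂ :=
          (Ctx.minus_mod_of_add Γ (by omega) (by omega)).symm.trans h₃
        rw [M.toPast_mod_of_add (r := u - τ) (by omega) (by omega) ht h₂ (by omega) h₃',
          M.toPast_mod_of_add (r := u - τ) (by omega) (by omega) hu' h₃ (by omega) h₃',
          ← bind_assoc (x := τ) _ _ _ hx.le (by omega), M.toPast_mod_bind hx.symm,
          le_bind]
    -- Both cuts end beyond `⟨τ⟩`: associativity splits off `⟨τ⟩` and the induction hypothesis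
    -- applies to `Γ`.
    · have h₁' : Γ.minus (s - τ) = Γ₁ :=
        (Ctx.minus_mod_of_add Γ (by omega) (by omega)).symm.trans h₁
      have h₃' : Γ.minus (u - τ) = Γ₂ :=
        (Ctx.minus_mod_of_add Γ (by omega) (by omega)).symm.trans h₃
      rw [M.toPast_mod_of_add (r := s - τ) (by omega) (by omega) hs h₁ (by omega) h₁',
        M.toPast_mod_of_add (r := u - τ) (by omega) (by omega) hu' h₃ (by omega) h₃',
        bind_assoc (z := u - τ) _ _ _ _ _ (by omega) (by omega),
        ih (by omega) (by omega) h₁' ht h₂ (by omega) h₃']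

end TypeModel

/-! # Lookup of variables -/

noncomputable section

variable {S : Signature.{u}} {C : Type v} [Category.{w} C]
  [CartesianMonoidalCategory C] [MonoidalClosed C]

namespace TypeModel

variable (M : TypeModel S C)

/-- `M.Look Γ n X g`: the variable with index `n` in `Γ` has type `X` and denotes `g`. -/
inductive Look : (Γ : Ctx S.Base) → ℕ → (X : VTy S.Base) →
    ((M.ctx Γ).obj (𝟙_ C) ⟶ M.ty X) → Prop
  | zero (Γ : Ctx S.Base) (X : VTy S.Base) :
      Look (Γ.var X) 0 X (snd ((M.ctx Γ).obj (𝟙_ C)) (M.ty X))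
  | succ {Γ : Ctx S.Base} {n : ℕ} {X : VTy S.Base} {g : (M.ctx Γ).obj (𝟙_ C) ⟶ M.ty X}
      (Y : VTy S.Base) (h : Look Γ n X g) :
      Look (Γ.var Y) (n + 1) X (M.wkVar Γ Y (𝟙_ C) ≫ g)
  | mod {Γ : Ctx S.Base} {n : ℕ} {X : VTy S.Base} {g : (M.ctx Γ).obj (𝟙_ C) ⟶ M.ty X}
      (τ : ℕ) (h : Look Γ n X g) :
      Look (Γ.mod τ) n X
        (M.openMod Γ τ (𝟙_ C) ≫ (M.past.counit τ).app ((M.ctx Γ).obj (𝟙_ C)) ≫ g)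

/-- The denotation of the variable `x` in `Γ, x : X, Γ'`. -/
def proj (Γ : Ctx S.Base) (X : VTy S.Base) (Γ' : Ctx S.Base) :
    (M.ctx ((Γ.var X).append Γ')).obj (𝟙_ C) ⟶ M.ty X :=
  (M.ι (Γ.var X) Γ').hom.app (𝟙_ C) ≫ M.e Γ' ((M.ctx (Γ.var X)).obj (𝟙_ C))
    ≫ (M.past.counit Γ'.time).app ((M.ctx (Γ.var X)).obj (𝟙_ C))
    ≫ snd ((M.ctx Γ).obj (𝟙_ C)) (M.ty X)

theorem proj_nil (Γ : Ctx S.Base) (X : VTy S.Base) :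
    M.proj Γ X .nil = snd ((M.ctx Γ).obj (𝟙_ C)) (M.ty X) := by
  refine (Category.id_comp _).trans ?_
  exact (reassoc_of% M.past.η_counit ((M.ctx (Γ.var X)).obj (𝟙_ C))) _

theorem proj_var (Γ : Ctx S.Base) (X : VTy S.Base) (Γ' : Ctx S.Base) (Y : VTy S.Base) :
    M.proj Γ X (Γ'.var Y) = M.wkVar ((Γ.var X).append Γ') Y (𝟙_ C) ≫ M.proj Γ X Γ' := by
  have aux : ∀ {A B D E F : C} (i : A ⟶ B) (e : B ⟶ D) (c : D ⟶ E) (s : E ⟶ F),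
      (i ▷ M.ty Y) ≫ (fst B (M.ty Y) ≫ e) ≫ c ≫ s = fst A (M.ty Y) ≫ i ≫ e ≫ c ≫ s := by
    intros; simp
  exact aux _ _ _ _

/-- An instance of `bind_counit`. It turns the variable clause, which collapses all modalities of
`Γ'` at once, into a recursion that discards them one by one, as in `Look`. -/
theorem proj_mod (Γ : Ctx S.Base) (X : VTy S.Base) (Γ' : Ctx S.Base) (τ : ℕ) :
    M.proj Γ X (Γ'.mod τ)
      = M.openMod ((Γ.var X).append Γ') τ (𝟙_ C)
        ≫ (M.past.counit τ).app ((M.ctx ((Γ.var X).append Γ')).obj (𝟙_ C)) ≫ M.proj Γ X Γ' := by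
  have aux : ∀ {A B D E : C} {b c : ℕ} (i : A ⟶ B) (e : B ⟶ (M.past.at b).obj D) (h : c ≤ τ + b)
      (s : D ⟶ E), (M.past.at τ).map i ≫ ((M.past.at τ).map e ≫ (M.past.μ τ b).hom.app D
        ≫ (M.past.le h).app D) ≫ (M.past.counit c).app D ≫ s
      = 𝟙 _ ≫ (M.past.counit τ).app A ≫ i ≫ e ≫ (M.past.counit b).app D ≫ s := by
    intro A B D E b c i e h s
    have h1 := (M.past.counit τ).naturality i
    have h2 := bind_counit (𝟙 _) e h
    rw [Category.id_comp] at h2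
    simp only [PastModality.bind, Category.id_comp, Category.assoc] at h2
    simp only [Functor.id_map] at h1
    simp only [Category.assoc, Category.id_comp]
    rw [← reassoc_of% h1, ← reassoc_of% h2]
  exact aux _ _ _ _

theorem look_proj (Γ : Ctx S.Base) (X : VTy S.Base) : ∀ Γ' : Ctx S.Base,
    M.Look ((Γ.var X).append Γ') Γ'.len X (M.proj Γ X Γ')
  | .nil => by rw [proj_nil]; exact .zero Γ X
  | .var Γ' Y => by rw [proj_var]; exact .succ Y (look_proj Γ X Γ')
  | .mod Γ' τ => by rw [proj_mod]; exact .mod τ (look_proj Γ X Γ')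

end TypeModel

namespace Model

variable [HasProducts.{u} C] [HasProducts.{0} C] (M : Model S C)

/-- `V` has a derivation that denotes `g`. -/
def Denotes (Γ : Ctx S.Base) (V : Val S) (X : VTy S.Base) (g : M.env Γ ⟶ M.ty X) : Prop :=
  ∃ d : VTyping S Γ V X, M.val d = g

theorem val_var {Δ : Ctx S.Base} (Γ Γ' : Ctx S.Base) (X : VTy S.Base) {n : ℕ}
    (hΔ : Δ = (Γ.var X).append Γ') (hn : n = Γ'.len) :
    M.val (.var (X := X) Γ Γ' hΔ hn) = eqToHom (congrArg M.env hΔ) ≫ M.proj Γ X Γ' :=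
  rfl

theorem look_val {Γ : Ctx S.Base} {n : ℕ} {X : VTy S.Base} (d : VTyping S Γ (.var n) X) :
    M.Look Γ n X (M.val d) := by
  cases d with
  | var Γ₁ Γ₂ hΔ hn =>
    subst hΔ hn
    rw [val_var, eqToHom_refl, Category.id_comp]
    exact M.look_proj Γ₁ X Γ₂

theorem denotes_of_look {Γ : Ctx S.Base} {n : ℕ} {X : VTy S.Base} {g : M.env Γ ⟶ M.ty X}
    (h : M.Look Γ n X g) : M.Denotes Γ (.var n) X g := by
  induction h with
  | zero Γ X =>
    exact ⟨.var Γ .nil rfl rfl, (Category.id_comp _).trans (M.proj_nil Γ X)⟩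
  | succ Y h ih =>
    obtain ⟨d, rfl⟩ := ih
    cases d with
    | var Γ₁ Γ₂ hΔ hn =>
      subst hΔ hn
      rw [val_var, eqToHom_refl, Category.id_comp]
      exact ⟨.var Γ₁ (Γ₂.var Y) rfl rfl, (Category.id_comp _).trans (M.proj_var Γ₁ _ Γ₂ Y)⟩
  | mod τ h ih =>
    obtain ⟨d, rfl⟩ := ih
    cases d with
    | var Γ₁ Γ₂ hΔ hn =>
      subst hΔ hn
      rw [val_var, eqToHom_refl, Category.id_comp]
      exact ⟨.var Γ₁ (Γ₂.mod τ) rfl rfl, (Category.id_comp _).trans (M.proj_mod Γ₁ _ Γ₂ τ)⟩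

end Model

-- Extension of environment morphisms and its compatibility with going back

namespace TypeModel

variable (M : TypeModel S C)

/-- The action of `-, x : X` on morphisms of environments. -/
def extVar {Γ Δ : Ctx S.Base} {A : C} (f : (M.ctx Δ).obj A ⟶ (M.ctx Γ).obj A) (X : VTy S.Base) :
    (M.ctx (Δ.var X)).obj A ⟶ (M.ctx (Γ.var X)).obj A :=
  f ▷ M.ty X

/-- The action of `-, ⟨τ⟩` on morphisms of environments. -/
def extMod {Γ Δ : Ctx S.Base} {A : C} (f : (M.ctx Δ).obj A ⟶ (M.ctx Γ).obj A) (τ : ℕ) :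
    (M.ctx (Δ.mod τ)).obj A ⟶ (M.ctx (Γ.mod τ)).obj A :=
  (M.past.at τ).map f

variable {M}

theorem extVar_wkVar {Γ Δ : Ctx S.Base} {A : C} (f : (M.ctx Δ).obj A ⟶ (M.ctx Γ).obj A)
    (X : VTy S.Base) : M.extVar f X ≫ M.wkVar Γ X A = M.wkVar Δ X A ≫ f :=
  whiskerRight_fst f (M.ty X)

theorem extMod_openMod {Γ Δ : Ctx S.Base} {A : C} (f : (M.ctx Δ).obj A ⟶ (M.ctx Γ).obj A)
    (τ : ℕ) : M.extMod f τ ≫ M.openMod Γ τ A = M.openMod Δ τ A ≫ (M.past.at τ).map f :=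
  (Category.comp_id _).trans (Category.id_comp _).symm

theorem toPast_zero_natural {Γ Δ : Ctx S.Base} {A : C}
    (f : (M.ctx Δ).obj A ⟶ (M.ctx Γ).obj A) (hΓ : 0 ≤ Γ.time) (hΓ₀ : Γ.minus 0 = Γ)
    (hΔ : 0 ≤ Δ.time) (hΔ₀ : Δ.minus 0 = Δ) :
    M.toPast hΔ hΔ₀ A ≫ (M.past.at 0).map f = f ≫ M.toPast hΓ hΓ₀ A := by
  rw [toPast_zero, toPast_zero]
  exact (M.past.η.hom.naturality f).symm

theorem toPast_extVar {Γ Δ Γ₀ Δ₀ : Ctx S.Base} {A : C} {τ : ℕ} (h0 : τ ≠ 0)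
    {f : (M.ctx Δ).obj A ⟶ (M.ctx Γ).obj A} {f₀ : (M.ctx Δ₀).obj A ⟶ (M.ctx Γ₀).obj A}
    {hΓ : τ ≤ Γ.time} {hΓ₀ : Γ.minus τ = Γ₀} {hΔ : τ ≤ Δ.time} {hΔ₀ : Δ.minus τ = Δ₀}
    (h : M.toPast hΔ hΔ₀ A ≫ (M.past.at τ).map f₀ = f ≫ M.toPast hΓ hΓ₀ A) (X : VTy S.Base)
    (hΓ' : τ ≤ (Γ.var X).time) (hΓ₀' : (Γ.var X).minus τ = Γ₀)
    (hΔ' : τ ≤ (Δ.var X).time) (hΔ₀' : (Δ.var X).minus τ = Δ₀) :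
    M.toPast hΔ' hΔ₀' A ≫ (M.past.at τ).map f₀ = M.extVar f X ≫ M.toPast hΓ' hΓ₀' A := by
  rw [M.toPast_var h0 hΔ' hΔ₀' hΔ hΔ₀, M.toPast_var h0 hΓ' hΓ₀' hΓ hΓ₀, Category.assoc, h,
    ← Category.assoc, ← Category.assoc, extVar_wkVar]

/-- The cut stops inside `⟨σ⟩`, so `f` itself survives under the leftover `⟨r⟩`. In `toPast_extMod`
the cut passes beyond `⟨σ⟩`, and the restriction `f₀` of `f` serves unchanged. -/
theorem toPast_extMod_add {Γ Δ : Ctx S.Base} {A : C} {σ τ r : ℕ} (e : τ + r = σ)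
    (f : (M.ctx Δ).obj A ⟶ (M.ctx Γ).obj A)
    (hΓ : τ ≤ (Γ.mod σ).time) (hΓ₀ : (Γ.mod σ).minus τ = Γ.mod r)
    (hΔ : τ ≤ (Δ.mod σ).time) (hΔ₀ : (Δ.mod σ).minus τ = Δ.mod r) :
    M.toPast hΔ hΔ₀ A ≫ (M.past.at τ).map (M.extMod f r)
      = M.extMod f σ ≫ M.toPast hΓ hΓ₀ A := by
  apply bind_iso_injective (M.openMod Γ r A)
  rw [PastModality.map_bind, extMod_openMod, PastModality.bind_map, comp_bind, M.toPast_mod_bind e, M.toPast_mod_bind e,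
    Category.assoc, ← NatTrans.naturality, ← Category.assoc, ← Category.assoc, extMod_openMod]

theorem toPast_extMod {Γ Δ Γ₀ Δ₀ : Ctx S.Base} {A : C} {σ τ r : ℕ} (e : τ = σ + r) (h0 : r ≠ 0)
    {f : (M.ctx Δ).obj A ⟶ (M.ctx Γ).obj A} {f₀ : (M.ctx Δ₀).obj A ⟶ (M.ctx Γ₀).obj A}
    {hΓ : r ≤ Γ.time} {hΓ₀ : Γ.minus r = Γ₀} {hΔ : r ≤ Δ.time} {hΔ₀ : Δ.minus r = Δ₀}
    (h : M.toPast hΔ hΔ₀ A ≫ (M.past.at r).map f₀ = f ≫ M.toPast hΓ hΓ₀ A)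
    (hΓ' : τ ≤ (Γ.mod σ).time) (hΓ₀' : (Γ.mod σ).minus τ = Γ₀)
    (hΔ' : τ ≤ (Δ.mod σ).time) (hΔ₀' : (Δ.mod σ).minus τ = Δ₀) :
    M.toPast hΔ' hΔ₀' A ≫ (M.past.at τ).map f₀ = M.extMod f σ ≫ M.toPast hΓ' hΓ₀' A := by
  rw [M.toPast_mod_of_add e h0 hΔ' hΔ₀' hΔ hΔ₀, M.toPast_mod_of_add e h0 hΓ' hΓ₀' hΓ hΓ₀,
    ← PastModality.bind_map, h, ← comp_bind, extMod_openMod, PastModality.map_bind]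

end TypeModel

namespace Model

variable [HasProducts.{u} C] [HasProducts.{0} C] (M : Model S C)

/-! # Weakening of environments -/

/-- `M.Wk Γ Δ f`: every variable of `Γ` is one of `Δ`, up to weakening by the last
`Δ.len - Γ.len` variables and passage of time, and `f` projects environments accordingly. -/
inductive Wk : (Γ Δ : Ctx S.Base) → (M.env Δ ⟶ M.env Γ) → Prop
  | id (Γ : Ctx S.Base) : Wk Γ Γ (𝟙 (M.env Γ))
  | comp {Γ Δ Θ : Ctx S.Base} {f : M.env Δ ⟶ M.env Γ} {g : M.env Θ ⟶ M.env Δ}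
      (hf : Wk Γ Δ f) (hg : Wk Δ Θ g) : Wk Γ Θ (g ≫ f)
  | var (Γ : Ctx S.Base) (X : VTy S.Base) : Wk Γ (Γ.var X) (M.wkVar Γ X (𝟙_ C))
  | mod (Γ : Ctx S.Base) (τ : ℕ) :
      Wk Γ (Γ.mod τ) (M.openMod Γ τ (𝟙_ C) ≫ (M.past.counit τ).app (M.env Γ))
  | past {Γ Γ₀ : Ctx S.Base} {t : ℕ} (ht : t ≤ Γ.time) (h : Γ.minus t = Γ₀) :
      Wk Γ₀ Γ (M.toPast ht h (𝟙_ C) ≫ (M.past.counit t).app (M.env Γ₀))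

variable {M}

theorem Wk.len_le {Γ Δ : Ctx S.Base} {f : M.env Δ ⟶ M.env Γ} (h : M.Wk Γ Δ f) :
    Γ.len ≤ Δ.len := by
  induction h with
  | id Γ => exact le_rfl
  | comp _ _ ih ih' => exact ih.trans ih'
  | var Γ X => exact Nat.le_succ _
  | mod Γ τ => exact le_rfl
  | past ht h => subst h; exact Ctx.len_minus_le _ _

theorem Wk.time_le {Γ Δ : Ctx S.Base} {f : M.env Δ ⟶ M.env Γ} (h : M.Wk Γ Δ f) :
    Γ.time ≤ Δ.time := by
  induction h with
  | id Γ => exact le_rfl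
  | comp _ _ ih ih' => exact ih.trans ih'
  | var Γ X => exact le_rfl
  | mod Γ τ => exact Nat.le_add_right _ _
  | past ht h => subst h; exact (Nat.le_add_right _ _).trans (Ctx.time_minus _ _ ht).le

/-- Weakenings restrict to earlier contexts. The constructor `past` is what makes this possible,
since the restriction of a modal weakening may be a passage from an earlier context; the squares
then follow from `toPast_bind`. -/
theorem Wk.minus {Γ Δ : Ctx S.Base} {f : M.env Δ ⟶ M.env Γ} (h : M.Wk Γ Δ f) :
    ∀ {τ : ℕ} {Γ₀ Δ₀ : Ctx S.Base} (hΓ : τ ≤ Γ.time) (hΓ₀ : Γ.minus τ = Γ₀) (hΔ : τ ≤ Δ.time)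
      (hΔ₀ : Δ.minus τ = Δ₀), ∃ f₀ : M.env Δ₀ ⟶ M.env Γ₀, M.Wk Γ₀ Δ₀ f₀ ∧
        M.toPast hΔ hΔ₀ (𝟙_ C) ≫ (M.past.at τ).map f₀ = f ≫ M.toPast hΓ hΓ₀ (𝟙_ C) := by
  induction h with
  | id Γ =>
    intro τ Γ₀ Δ₀ hΓ hΓ₀ hΔ hΔ₀
    obtain rfl : Γ₀ = Δ₀ := hΓ₀.symm.trans hΔ₀
    exact ⟨_, .id _, by simp⟩
  | @comp Γ Δ Θ f g hf hg ih ih' =>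
    intro τ Γ₀ Θ₀ hΓ hΓ₀ hΘ hΘ₀
    obtain ⟨f₀, hf₀, h₁⟩ := ih hΓ hΓ₀ (hΓ.trans hf.time_le) rfl
    obtain ⟨g₀, hg₀, h₂⟩ := ih' (hΓ.trans hf.time_le) rfl hΘ hΘ₀
    refine ⟨_, .comp hf₀ hg₀, ?_⟩
    rw [CategoryTheory.Functor.map_comp, reassoc_of% h₂, h₁, Category.assoc]
  | var Γ X =>
    intro τ Γ₀ Δ₀ hΓ hΓ₀ hΔ hΔ₀
    rcases Nat.eq_zero_or_pos τ with rfl | h0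
    · obtain rfl : Γ = Γ₀ := (Ctx.minus_zero _).symm.trans hΓ₀
      obtain rfl : Γ.var X = Δ₀ := (Ctx.minus_zero _).symm.trans hΔ₀
      exact ⟨_, .var Γ X, TypeModel.toPast_zero_natural _ _ _ _ _⟩
    · obtain rfl : Γ₀ = Δ₀ := hΓ₀.symm.trans ((Ctx.minus_var Γ X h0.ne').symm.trans hΔ₀)
      exact ⟨_, .id _, by
        rw [M.toPast_var h0.ne' hΔ hΔ₀ hΓ hΓ₀, CategoryTheory.Functor.map_id, Category.comp_id]⟩
  | mod Γ σ =>
    intro τ Γ₀ Δ₀ hΓ hΓ₀ hΔ hΔ₀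
    by_cases hτ : τ ≤ σ
    -- Here `Δ₀` is `Γ, ⟨r⟩`: the leftover `⟨r⟩` is discarded, and then `Γ` is taken back by the
    -- full `τ`.
    · obtain ⟨r, rfl⟩ := Nat.exists_eq_add_of_le hτ
      obtain rfl : Γ.mod r = Δ₀ := (Ctx.minus_mod_add Γ rfl).symm.trans hΔ₀
      refine ⟨_, .comp (.past hΓ hΓ₀) (.mod Γ r), ?_⟩
      rw [← Category.assoc _ (M.toPast hΓ hΓ₀ (𝟙_ C)), comp_map_counit, Category.assoc,
        Category.assoc, comp_counit_comp, comp_counit_comp,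
        ← bind_assoc (x := τ) _ _ _ (by omega) (by omega), M.toPast_mod_bind rfl, le_bind]
    -- Here `Δ₀` is `Γ - r` and `Γ₀` is `Γ - (σ + r)`, so that `Γ₀` is `Δ₀ - σ`.
    · obtain ⟨r, rfl⟩ := Nat.exists_eq_add_of_le (Nat.le_of_not_le hτ)
      have hr : r ≠ 0 := by omega
      have hΔ₁ := (Ctx.minus_mod_of_add Γ rfl hr).symm.trans hΔ₀
      have hr' : r ≤ Γ.time := by omega
      have ht := Ctx.time_minus Γ r hr'
      have hm := Ctx.minus_minus Γ r σ
      rw [hΔ₁] at ht hm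
      have hΓ₁ : Δ₀.minus σ = Γ₀ := by rw [hm, Nat.add_comm, hΓ₀]
      refine ⟨_, .past (t := σ) (by omega) hΓ₁, ?_⟩
      rw [comp_map_counit, Category.assoc, comp_counit_comp,
        M.toPast_mod_of_add rfl hr hΔ hΔ₀ hr' hΔ₁,
        bind_assoc (z := σ + r) _ _ _ _ _ (by omega) (by omega),
        M.toPast_bind _ Γ (Nat.add_comm σ r) hr' hΔ₁ _ hΓ₁ hΓ hΓ₀]
  | @past Δ Γ t ht h =>
    -- The cuts by `t` and by `τ` commute: both orders lead to `Δ - (τ + t)`, so going back by `t`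
    -- is again the restriction.
    intro τ Γ₀ Δ₀ hΓ hΓ₀ hΔ hΔ₀
    have h1 := Ctx.time_minus Δ t ht
    have h2 := Ctx.time_minus Δ τ hΔ
    have h3 : Δ.minus (τ + t) = Γ₀ := by
      rw [Nat.add_comm, ← Ctx.minus_minus, h, hΓ₀]
    have h4 : Δ₀.minus t = Γ₀ := by rw [← hΔ₀, Ctx.minus_minus, h3]
    rw [h] at h1
    rw [hΔ₀] at h2
    refine ⟨_, .past (t := t) (by omega) h4, ?_⟩
    rw [comp_map_counit, Category.assoc, comp_counit_comp,
      ← bind_le _ _ (le_refl (τ + t)) (Nat.le_add_right τ t),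
      ← bind_le _ _ (Nat.add_comm τ t).le (Nat.le_add_right τ t),
      M.toPast_bind _ Δ rfl hΔ hΔ₀ _ h4 (by omega) h3,
      M.toPast_bind _ Δ (Nat.add_comm τ t) ht h hΓ hΓ₀ (by omega) h3]

/-- Going back by `t` and discarding that time agrees, on a variable that survives the cut, with
discarding the modalities passed on the way one at a time; `bind_counit` is the step at a modality.
-/
theorem look_past {X : VTy S.Base} : ∀ {Γ Γ₀ : Ctx S.Base} {t n : ℕ} {g : M.env Γ₀ ⟶ M.ty X}
    (ht : t ≤ Γ.time) (h : Γ.minus t = Γ₀), M.Look Γ₀ n X g →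
    M.Look Γ (n + (Γ.len - Γ₀.len)) X
      (M.toPast ht h (𝟙_ C) ≫ (M.past.counit t).app (M.env Γ₀) ≫ g) := by
  intro Γ
  induction Γ with
  | nil =>
    intro Γ₀ t n g ht h hl
    obtain rfl : t = 0 := Nat.le_zero.1 ht
    obtain rfl : Ctx.nil = Γ₀ := h
    cases hl
  | var Γ Y ih =>
    intro Γ₀ t n g ht h hl
    rcases Nat.eq_zero_or_pos t with rfl | h0
    · obtain rfl : Γ.var Y = Γ₀ := (Ctx.minus_zero _).symm.trans h
      rw [M.toPast_zero ht, Nat.sub_self, reassoc_of% M.past.η_counit (M.env (Γ.var Y))]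
      exact hl
    · have ht' : t ≤ Γ.time := ht
      have h' : Γ.minus t = Γ₀ := (Ctx.minus_var Γ Y h0.ne').symm.trans h
      have hlen : Γ₀.len ≤ Γ.len := h' ▸ Ctx.len_minus_le Γ t
      have e : n + ((Γ.var Y).len - Γ₀.len) = n + (Γ.len - Γ₀.len) + 1 := by
        simp only [Ctx.len]; omega
      rw [e, M.toPast_var h0.ne' ht h ht' h', Category.assoc]
      exact .succ Y (ih ht' h' hl)
  | mod Γ τ ih =>
    intro Γ₀ t n g ht h hl
    rcases Nat.eq_zero_or_pos t with rfl | h0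
    · obtain rfl : Γ.mod τ = Γ₀ := (Ctx.minus_zero _).symm.trans h
      rw [M.toPast_zero ht, Nat.sub_self, reassoc_of% M.past.η_counit (M.env (Γ.mod τ))]
      exact hl
    by_cases hτ : t ≤ τ
    · obtain ⟨r, rfl⟩ := Nat.exists_eq_add_of_le hτ
      obtain rfl : Γ.mod r = Γ₀ := (Ctx.minus_mod_add Γ rfl).symm.trans h
      cases hl with
      | @mod _ _ _ g _ hl =>
        have e : n + ((Γ.mod (t + r)).len - (Γ.mod r).len) = n := by simp [Ctx.len]
        have h1 := bind_counit (M.toPast ht h (𝟙_ C)) (M.openMod Γ r (𝟙_ C)) (le_refl (t + r))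
        rw [M.toPast_mod_bind rfl, Category.assoc, le_counit] at h1
        rw [e, ← reassoc_of% h1]
        exact .mod _ hl
    · obtain ⟨r, rfl⟩ := Nat.exists_eq_add_of_le (Nat.le_of_not_le hτ)
      have hr : r ≠ 0 := by omega
      have hr' : r ≤ Γ.time := Nat.le_of_add_le_add_left (ht.trans (Nat.add_comm Γ.time τ).le)
      have h' := (Ctx.minus_mod_of_add Γ rfl hr).symm.trans h
      have h1 := bind_counit (M.openMod Γ τ (𝟙_ C)) (M.toPast hr' h' (𝟙_ C)) (le_refl (τ + r))
      rw [M.toPast_mod_of_add rfl hr ht h hr' h', reassoc_of% h1]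
      exact .mod τ (ih hr' h' hl)

end Model

/-! # Naturality of the semantic operations in the environment -/

theorem curr_whiskerRight {P Q A B : C} (f : P ⟶ Q) (g : Q ⊗ A ⟶ B) :
    curr (f ▷ A ≫ g) = f ≫ curr g := by
  rw [curr, curr, ← MonoidalClosed.curry_natural_left]
  rw [← Category.assoc, ← Category.assoc]
  congr 2
  ext <;> simp

namespace TypeModel

variable (M : TypeModel S C)

theorem unit_map_comp {D G X : C} {τ : ℕ} (f : D ⟶ G) (n : (M.past.at τ).obj G ⟶ X) :
    (M.adj τ).unit.app D ≫ (M.fut.at τ).map ((M.past.at τ).map f ≫ n)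
      = f ≫ (M.adj τ).unit.app G ≫ (M.fut.at τ).map n := by
  simp

/-- The environment reaches the continuation through the adjunction unit and the strength, both
natural. Shared by `let` and `handle`. -/
theorem lift_unit_str {D G X Y : C} {τ : ℕ} (f : D ⟶ G) (m : G ⟶ (M.T τ).obj X)
    (n : (M.past.at τ).obj G ⊗ X ⟶ Y) :
    lift ((M.adj τ).unit.app D) (f ≫ m) ≫ M.str ((M.past.at τ).obj D) X τ
        ≫ (M.T τ).map ((M.past.at τ).map f ▷ X ≫ n)
      = f ≫ lift ((M.adj τ).unit.app G) m ≫ M.str ((M.past.at τ).obj G) X τ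
        ≫ (M.T τ).map n := by
  have h := M.str_natural ((M.past.at τ).map f) (𝟙 X) τ
  rw [tensorHom_id, CategoryTheory.Functor.map_id] at h
  rw [CategoryTheory.Functor.map_comp, ← reassoc_of% h, ← Category.assoc, ← Category.assoc f]
  congr 1
  ext <;> simp

end TypeModel

namespace Model

variable [HasProducts.{u} C] [HasProducts.{0} C] (M : Model S C)

/-! # Substitution along morphisms of environments -/

/-- `M.Earlier P Γ Δ σ f`: the substitution `σ` and the morphism `f` restrict along `P` to all
earlier contexts of `Γ` and `Δ`. -/
def Earlier (P : (Γ Δ : Ctx S.Base) → (ℕ → Val S) → (M.env Δ ⟶ M.env Γ) → Prop)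
    (Γ Δ : Ctx S.Base) (σ : ℕ → Val S) (f : M.env Δ ⟶ M.env Γ) : Prop :=
  ∀ {τ : ℕ} {Γ₀ Δ₀ : Ctx S.Base} (hΓ : τ ≤ Γ.time) (hΓ₀ : Γ.minus τ = Γ₀) (hΔ : τ ≤ Δ.time)
    (hΔ₀ : Δ.minus τ = Δ₀), ∃ (σ₀ : ℕ → Val S) (f₀ : M.env Δ₀ ⟶ M.env Γ₀), P Γ₀ Δ₀ σ₀ f₀ ∧
      (∀ n, σ (n + (Γ.len - Γ₀.len)) = (σ₀ n).shift (Δ.len - Δ₀.len) 0) ∧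
      M.toPast hΔ hΔ₀ (𝟙_ C) ≫ (M.past.at τ).map f₀ = f ≫ M.toPast hΓ hΓ₀ (𝟙_ C)

/-- The conditions on a class `P` of substitutions, with their denotations, under which all
well-typed terms can be substituted into. -/
structure IsSubstClass (P : (Γ Δ : Ctx S.Base) → (ℕ → Val S) → (M.env Δ ⟶ M.env Γ) → Prop) :
    Prop where
  var {Γ Δ : Ctx S.Base} {σ : ℕ → Val S} {f : M.env Δ ⟶ M.env Γ} (h : P Γ Δ σ f)
    (X : VTy S.Base) : P (Γ.var X) (Δ.var X) (liftSub σ) (M.extVar f X)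
  mod {Γ Δ : Ctx S.Base} {σ : ℕ → Val S} {f : M.env Δ ⟶ M.env Γ} (h : P Γ Δ σ f)
    (τ : ℕ) : P (Γ.mod τ) (Δ.mod τ) σ (M.extMod f τ)
  look {Γ Δ : Ctx S.Base} {σ : ℕ → Val S} {f : M.env Δ ⟶ M.env Γ} (h : P Γ Δ σ f)
    {n : ℕ} {X : VTy S.Base} {g : M.env Γ ⟶ M.ty X} (hg : M.Look Γ n X g) :
    M.Denotes Δ (σ n) X (f ≫ g)
  time_le {Γ Δ : Ctx S.Base} {σ : ℕ → Val S} {f : M.env Δ ⟶ M.env Γ} (h : P Γ Δ σ f) :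
    Γ.time ≤ Δ.time
  earlier {Γ Δ : Ctx S.Base} {σ : ℕ → Val S} {f : M.env Δ ⟶ M.env Γ} (h : P Γ Δ σ f) :
    M.Earlier P Γ Δ σ f

variable {M} {P : (Γ Δ : Ctx S.Base) → (ℕ → Val S) → (M.env Δ ⟶ M.env Γ) → Prop}

-- Induction on the derivation. Variables use `look`, binders and modalities use `var` and `mod`,
-- and `unbox` uses `earlier`; the equation of morphisms is in each case naturality of the clause in
-- the environment.
mutual
theorem IsSubstClass.exists_val (hP : M.IsSubstClass P) : ∀ {Γ Δ : Ctx S.Base} {V : Val S}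
    {X : VTy S.Base} {σ : ℕ → Val S} {f : M.env Δ ⟶ M.env Γ} (d : VTyping S Γ V X),
    P Γ Δ σ f → ∃ d' : VTyping S Δ (V.sbst σ) X, M.val d' = f ≫ M.val d
  | _, _, _, _, _, _, .var Γ₁ Γ₂ hΔ hn, h => hP.look h (M.look_val (.var Γ₁ Γ₂ hΔ hn))
  | _, _, _, _, _, f, .const c dVs, h => by
      choose d' hd' using fun i => hP.exists_val (dVs i) h
      refine ⟨.const c d', ?_⟩
      simp only [val, hd', ← Category.assoc]
      congr 1
      exact Pi.hom_ext _ _ fun i => by simp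
  | _, _, _, _, _, f, .unit, h => ⟨.unit, toUnit_unique _ _⟩
  | _, _, _, _, _, f, .pair dV dW, h => by
      obtain ⟨dV', hV⟩ := hP.exists_val dV h
      obtain ⟨dW', hW⟩ := hP.exists_val dW h
      refine ⟨.pair dV' dW', ?_⟩
      simp only [val, hV, hW]
      exact (comp_lift _ _ _).symm
  | _, _, _, _, _, f, .fn (X := X) dM, h => by
      obtain ⟨dM', hM⟩ := hP.exists_cmp dM (hP.var h X)
      refine ⟨.fn dM', ?_⟩
      simp only [val, hM]
      exact curr_whiskerRight f _
  | _, _, _, _, _, f, .box (τ := τ) dV, h => by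
      obtain ⟨dV', hV⟩ := hP.exists_val dV (hP.mod h τ)
      refine ⟨.box dV', ?_⟩
      simp only [val, hV]
      exact M.unit_map_comp f _
theorem IsSubstClass.exists_cmp (hP : M.IsSubstClass P) : ∀ {Γ Δ : Ctx S.Base} {N : Cmp S}
    {X : VTy S.Base} {τ : ℕ} {σ : ℕ → Val S} {f : M.env Δ ⟶ M.env Γ} (d : CTyping S Γ N X τ),
    P Γ Δ σ f → ∃ d' : CTyping S Δ (N.sbst σ) X τ, M.cmp d' = f ≫ M.cmp d
  | _, _, _, _, _, _, f, .ret dV, h => by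
      obtain ⟨dV', hV⟩ := hP.exists_val dV h
      exact ⟨.ret dV', by simp only [cmp, hV, Category.assoc]⟩
  | _, _, _, _, _, _, f, .letIn (X := X) (τ := τ) dM dN, h => by
      obtain ⟨dM', hM⟩ := hP.exists_cmp dM h
      obtain ⟨dN', hN⟩ := hP.exists_cmp dN (hP.var (hP.mod h τ) X)
      refine ⟨.letIn dM' dN', ?_⟩
      simp only [cmp, hM, hN]
      have h1 := congrArg (· ≫ (M.μT _ _).app _) (M.lift_unit_str f (M.cmp dM) (M.cmp dN))
      simp only [Category.assoc] at h1
      exact h1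
  | _, _, _, _, _, _, f, .app dV dW, h => by
      obtain ⟨dV', hV⟩ := hP.exists_val dV h
      obtain ⟨dW', hW⟩ := hP.exists_val dW h
      refine ⟨.app dV' dW', ?_⟩
      simp only [cmp, hV, hW]
      exact (comp_lift_assoc _ _ _ _).symm
  | _, _, _, _, _, _, f, .matchPair (X := X) (Y := Y) dV dN, h => by
      obtain ⟨dV', hV⟩ := hP.exists_val dV h
      obtain ⟨dN', hN⟩ := hP.exists_cmp dN (hP.var (hP.var h X) Y)
      refine ⟨.matchPair dV' dN', ?_⟩
      simp only [cmp, hV, hN]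
      have aux : ∀ {D G A B E : C} (f : D ⟶ G) (v : G ⟶ A ⊗ B) (n : (G ⊗ A) ⊗ B ⟶ E),
          lift (𝟙 D) (f ≫ v) ≫ (α_ D A B).inv ≫ (f ▷ A) ▷ B ≫ n
            = f ≫ lift (𝟙 G) v ≫ (α_ G A B).inv ≫ n := by
        intro D G A B E f v n
        simp only [← Category.assoc]
        congr 1
        ext <;> simp
      exact aux f _ _
  | _, _, _, _, _, _, f, .op (τ := τ) o dV dM, h => by
      obtain ⟨dV', hV⟩ := hP.exists_val dV h
      obtain ⟨dM', hM⟩ := hP.exists_cmp dM (hP.var (hP.mod h (S.opTime o)) (S.opRes o).toVTy)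
      refine ⟨.op o dV' dM', ?_⟩
      simp only [cmp, hV, hM]
      have aux : ∀ {D G A B E : C} {t : ℕ} (f : D ⟶ G) (v : G ⟶ A)
          (n : (M.past.at t).obj G ⊗ B ⟶ E),
          lift (f ≫ v) ((M.adj t).unit.app D)
              ≫ (A ◁ (M.fut.at t).map (curr ((M.past.at t).map f ▷ B ≫ n)))
            = f ≫ lift v ((M.adj t).unit.app G) ≫ (A ◁ (M.fut.at t).map (curr n)) := by
        intro D G A B E t f v n
        rw [curr_whiskerRight]
        ext <;> simp
      have h1 := congrArg (· ≫ (M.opT o τ).app _)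
        (aux (t := S.opTime o) f (M.val dV) (M.cmp dM))
      simp only [Category.assoc] at h1
      exact h1
  | _, _, _, _, _, _, f, .delay (τ := τ) dM, h => by
      obtain ⟨dM', hM⟩ := hP.exists_cmp dM (hP.mod h τ)
      refine ⟨.delay dM', ?_⟩
      simp only [cmp, hM]
      have h1 := congrArg (· ≫ (M.delayT τ _).app _) (M.unit_map_comp f (M.cmp dM))
      simp only [Category.assoc] at h1
      exact h1
  | _, _, _, _, _, _, f, .handle (X := X) (Y := Y) (τ := τ) (τ' := τ') dM dN dH, h => by
      obtain ⟨dM', hM⟩ := hP.exists_cmp dM h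
      obtain ⟨dN', hN⟩ := hP.exists_cmp dN (hP.var (hP.mod h τ) X)
      choose dH' hH using fun o τ'' =>
        hP.exists_cmp (dH o τ'') (hP.var (hP.var h _) _)
      refine ⟨.handle dM' dN' dH', ?_⟩
      simp only [cmp, hM, hN, hH]
      have aux : ∀ {D G K Q R E Q' R' : C} (f : D ⟶ G) (l' : D ⟶ Q') (s' : Q' ⟶ R')
          (t' : R' ⟶ E) (l : G ⟶ Q) (s : Q ⟶ R) (t : R ⟶ E) (k : G ⟶ K) (k' : D ⟶ K)
          {Z : C} (u : K ⊗ E ⟶ Z), l' ≫ s' ≫ t' = f ≫ l ≫ s ≫ t → k' = f ≫ k →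
          lift (𝟙 D) l' ≫ (D ◁ s') ≫ (D ◁ t') ≫ (k' ▷ E) ≫ u
            = f ≫ lift (𝟙 G) l ≫ (G ◁ s) ≫ (G ◁ t) ≫ (k ▷ E) ≫ u := by
        rintro D G K Q R E Q' R' f l' s' t' l s t k k' Z u h rfl
        simp only [← Category.assoc]
        congr 1
        ext
        · simp
        · simpa using h
      have aux' : ∀ {D G A B E : C} (f : D ⟶ G) (n : (G ⊗ A) ⊗ B ⟶ E),
          curr ((α_ D A B).inv ≫ (f ▷ A) ▷ B ≫ n) = f ≫ curr ((α_ G A B).inv ≫ n) := by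
        intro D G A B E f n
        rw [← curr_whiskerRight]
        congr 1
        simp
      refine aux f _ _ _ _ _ _ _ _ _ (M.lift_unit_str f (M.cmp dM) (M.cmp dN)) ?_
      refine Pi.hom_ext _ _ fun o => Pi.hom_ext _ _ fun τ'' => ?_
      simp only [Category.assoc, limit.lift_π, Fan.mk_π_app]
      exact aux' f _
  | _, Δ, _, _, _, σ, f, .unbox (X := X) (τ := τ) hτ hV dV dN, h => by
      have hτ' := hτ.trans (hP.time_le h)
      -- The unboxed value lives in the earlier context, so the induction hypothesis is applied to
      -- the restriction. `hσ` supplies the shift condition of the rule and `hf` the semantic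
      -- square.
      obtain ⟨σ₀, f₀, h₀, hσ, hf⟩ := hP.earlier h hτ rfl hτ' rfl
      obtain ⟨dV', hV'⟩ := hP.exists_val dV h₀
      obtain ⟨dN', hN⟩ := hP.exists_cmp dN (hP.var h X)
      refine ⟨.unbox hτ' (by rw [hV]; exact Val.sbst_shift_comm _ hσ) dV' dN', ?_⟩
      simp only [cmp, hV', hN]
      rw [M.toPast_rfl, M.toPast_rfl] at hf
      have aux : ∀ {D G X Q Q' Z E : C} (f : D ⟶ G) (p' : D ⟶ Q') (v' : Q' ⟶ Z) (p : G ⟶ Q)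
          (v : Q ⟶ Z) (c : Z ⟶ X) (n : G ⊗ X ⟶ E), p' ≫ v' = f ≫ p ≫ v →
          lift (𝟙 D) p' ≫ (D ◁ v') ≫ (D ◁ c) ≫ f ▷ X ≫ n
            = f ≫ lift (𝟙 G) p ≫ (G ◁ v) ≫ (G ◁ c) ≫ n := by
        intro D G X Q Q' Z E f p' v' p v c n h
        simp only [← Category.assoc]
        congr 1
        ext
        · simp
        · simpa using congrArg (· ≫ c) h
      refine aux f _ _ _ _ _ _ ?_
      rw [CategoryTheory.Functor.map_comp, reassoc_of% hf]
end

-- Closing a class of substitutions under context extension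

theorem Earlier.mono {P Q : (Γ Δ : Ctx S.Base) → (ℕ → Val S) → (M.env Δ ⟶ M.env Γ) → Prop}
    {Γ Δ : Ctx S.Base} {σ : ℕ → Val S} {f : M.env Δ ⟶ M.env Γ} (h : M.Earlier P Γ Δ σ f)
    (hPQ : ∀ {Γ Δ σ f}, P Γ Δ σ f → Q Γ Δ σ f) : M.Earlier Q Γ Δ σ f := by
  intro τ Γ₀ Δ₀ hΓ hΓ₀ hΔ hΔ₀
  obtain ⟨σ₀, f₀, h₀, h'⟩ := h hΓ hΓ₀ hΔ hΔ₀
  exact ⟨σ₀, f₀, hPQ h₀, h'⟩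

/-- The closure of a class of substitutions under extending both contexts. -/
inductive Ext (G : (Γ Δ : Ctx S.Base) → (ℕ → Val S) → (M.env Δ ⟶ M.env Γ) → Prop) :
    (Γ Δ : Ctx S.Base) → (ℕ → Val S) → (M.env Δ ⟶ M.env Γ) → Prop
  | base {Γ Δ : Ctx S.Base} {σ : ℕ → Val S} {f : M.env Δ ⟶ M.env Γ} (h : G Γ Δ σ f) :
      Ext G Γ Δ σ f
  | var {Γ Δ : Ctx S.Base} {σ : ℕ → Val S} {f : M.env Δ ⟶ M.env Γ} (h : Ext G Γ Δ σ f)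
      (X : VTy S.Base) : Ext G (Γ.var X) (Δ.var X) (liftSub σ) (M.extVar f X)
  | mod {Γ Δ : Ctx S.Base} {σ : ℕ → Val S} {f : M.env Δ ⟶ M.env Γ} (h : Ext G Γ Δ σ f)
      (τ : ℕ) : Ext G (Γ.mod τ) (Δ.mod τ) σ (M.extMod f τ)

variable {G : (Γ Δ : Ctx S.Base) → (ℕ → Val S) → (M.env Δ ⟶ M.env Γ) → Prop}

theorem Ext.time_le (hG : ∀ {Γ Δ σ f}, G Γ Δ σ f → Γ.time ≤ Δ.time) {Γ Δ : Ctx S.Base}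
    {σ : ℕ → Val S} {f : M.env Δ ⟶ M.env Γ} (h : Ext G Γ Δ σ f) : Γ.time ≤ Δ.time := by
  induction h with
  | base h => exact hG h
  | var h X ih => exact ih
  | mod h τ ih => exact Nat.add_le_add_right ih τ

/-- The predicate `Q` is left open because closure under `hvar` and `hmod` is itself weakening. For
weakenings, `Q` says that the value is a variable, where this is immediate; for substitutions, `Q`
is `Denotes`, where the weakening lemma supplies it. -/
theorem Ext.look {Q : (Γ : Ctx S.Base) → Val S → (X : VTy S.Base) → (M.env Γ ⟶ M.ty X) → Prop}
    (hlook : ∀ {Γ n X g}, M.Look Γ n X g → Q Γ (.var n) X g)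
    (hvar : ∀ {Γ V X g} (Y), Q Γ V X g → Q (Γ.var Y) (V.shift 1 0) X (M.wkVar Γ Y (𝟙_ C) ≫ g))
    (hmod : ∀ {Γ V X g} (τ), Q Γ V X g →
      Q (Γ.mod τ) V X (M.openMod Γ τ (𝟙_ C) ≫ (M.past.counit τ).app (M.env Γ) ≫ g))
    (hG : ∀ {Γ Δ σ f n X g}, G Γ Δ σ f → M.Look Γ n X g → Q Δ (σ n) X (f ≫ g))
    {Γ Δ : Ctx S.Base} {σ : ℕ → Val S} {f : M.env Δ ⟶ M.env Γ} (h : Ext G Γ Δ σ f) :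
    ∀ {n : ℕ} {X : VTy S.Base} {g : M.env Γ ⟶ M.ty X}, M.Look Γ n X g →
      Q Δ (σ n) X (f ≫ g) := by
  induction h with
  | base h => exact hG h
  | @var Γ Δ σ f h X ih =>
    intro n Y g hg
    cases hg with
    | zero =>
      have e : M.extVar f X ≫ snd (M.env Γ) (M.ty X) = snd (M.env Δ) (M.ty X) :=
        whiskerRight_snd f (M.ty X)
      rw [e]
      exact hlook (.zero Δ X)
    | succ _ hg =>
      rw [← Category.assoc, TypeModel.extVar_wkVar, Category.assoc]
      exact hvar X (ih hg)
  | @mod Γ Δ σ f h τ ih =>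
    intro n Y g hg
    cases hg with
    | mod _ hg =>
      have e := (M.past.counit τ).naturality f
      simp only [Functor.id_map] at e
      rw [← Category.assoc, TypeModel.extMod_openMod, Category.assoc, reassoc_of% e]
      exact hmod τ (ih hg)

/-- A cut either stops within the added extension, leaving a shorter extension of the same pair, or
reaches the generating pair, where `hG` applies. -/
theorem Ext.earlier (hG : ∀ {Γ Δ σ f}, G Γ Δ σ f → M.Earlier (Ext G) Γ Δ σ f)
    {Γ Δ : Ctx S.Base} {σ : ℕ → Val S} {f : M.env Δ ⟶ M.env Γ} (h : Ext G Γ Δ σ f) :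
    M.Earlier (Ext G) Γ Δ σ f := by
  -- A cut by `0` is separate, since it keeps trailing variables that any positive cut drops.
  have zero : ∀ {Γ Δ : Ctx S.Base} {σ : ℕ → Val S} {f : M.env Δ ⟶ M.env Γ}
      {Γ₀ Δ₀ : Ctx S.Base}, Ext G Γ Δ σ f → ∀ (hΓ : 0 ≤ Γ.time) (hΓ₀ : Γ.minus 0 = Γ₀)
      (hΔ : 0 ≤ Δ.time) (hΔ₀ : Δ.minus 0 = Δ₀), ∃ (σ₀ : ℕ → Val S) (f₀ : M.env Δ₀ ⟶ M.env Γ₀),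
        Ext G Γ₀ Δ₀ σ₀ f₀ ∧
        (∀ n, σ (n + (Γ.len - Γ₀.len)) = (σ₀ n).shift (Δ.len - Δ₀.len) 0) ∧
        M.toPast hΔ hΔ₀ (𝟙_ C) ≫ (M.past.at 0).map f₀ = f ≫ M.toPast hΓ hΓ₀ (𝟙_ C) := by
    intro Γ Δ σ f Γ₀ Δ₀ h hΓ hΓ₀ hΔ hΔ₀
    obtain rfl : Γ = Γ₀ := (Ctx.minus_zero _).symm.trans hΓ₀
    obtain rfl : Δ = Δ₀ := (Ctx.minus_zero _).symm.trans hΔ₀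
    exact ⟨σ, f, h, fun n => by simp [Val.shift_zero], TypeModel.toPast_zero_natural f _ _ _ _⟩
  induction h with
  | base h => exact hG h
  | @var Γ Δ σ f h X ih =>
    intro τ Γ₀ Δ₀ hΓ hΓ₀ hΔ hΔ₀
    rcases Nat.eq_zero_or_pos τ with rfl | h0
    · exact zero (.var h X) hΓ hΓ₀ hΔ hΔ₀
    · have hΓ₁ : Γ.minus τ = Γ₀ := (Ctx.minus_var Γ X h0.ne').symm.trans hΓ₀
      have hΔ₁ : Δ.minus τ = Δ₀ := (Ctx.minus_var Δ X h0.ne').symm.trans hΔ₀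
      have hlΓ : Γ₀.len ≤ Γ.len := hΓ₁ ▸ Ctx.len_minus_le Γ τ
      have hlΔ : Δ₀.len ≤ Δ.len := hΔ₁ ▸ Ctx.len_minus_le Δ τ
      obtain ⟨σ₀, f₀, h₀, hσ, hf⟩ := ih (τ := τ) hΓ hΓ₁ hΔ hΔ₁
      refine ⟨σ₀, f₀, h₀, fun n => ?_, TypeModel.toPast_extVar h0.ne' hf X _ _ _ _⟩
      have e₁ : n + ((Γ.var X).len - Γ₀.len) = n + (Γ.len - Γ₀.len) + 1 := by
        simp only [Ctx.len]; omega
      have e₂ : (Δ.var X).len - Δ₀.len = Δ.len - Δ₀.len + 1 := by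
        simp only [Ctx.len]; omega
      rw [e₁, e₂, ← Val.shift_shift, ← hσ]
      rfl
  | @mod Γ Δ σ f h t ih =>
    intro τ Γ₀ Δ₀ hΓ hΓ₀ hΔ hΔ₀
    by_cases hτ : τ ≤ t
    · obtain ⟨r, rfl⟩ := Nat.exists_eq_add_of_le hτ
      obtain rfl : Γ.mod r = Γ₀ := (Ctx.minus_mod_add Γ rfl).symm.trans hΓ₀
      obtain rfl : Δ.mod r = Δ₀ := (Ctx.minus_mod_add Δ rfl).symm.trans hΔ₀
      exact ⟨σ, _, .mod h r, fun n => by simp [Ctx.len, Val.shift_zero],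
        TypeModel.toPast_extMod_add rfl f _ _ _ _⟩
    · obtain ⟨r, rfl⟩ := Nat.exists_eq_add_of_le (Nat.le_of_not_le hτ)
      have hr : r ≠ 0 := by omega
      have hrΓ : r ≤ Γ.time :=
        Nat.le_of_add_le_add_left (hΓ.trans (Nat.add_comm Γ.time t).le)
      have hrΔ : r ≤ Δ.time :=
        Nat.le_of_add_le_add_left (hΔ.trans (Nat.add_comm Δ.time t).le)
      obtain ⟨σ₀, f₀, h₀, hσ, hf⟩ := ih hrΓ ((Ctx.minus_mod_of_add Γ rfl hr).symm.trans hΓ₀)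
        hrΔ ((Ctx.minus_mod_of_add Δ rfl hr).symm.trans hΔ₀)
      exact ⟨σ₀, f₀, h₀, hσ, TypeModel.toPast_extMod rfl hr hf _ _ _ _⟩

variable (M)

/-! # Weakening -/

/-- The weakenings, as substitutions. -/
def WkSub (Γ Δ : Ctx S.Base) (σ : ℕ → Val S) (f : M.env Δ ⟶ M.env Γ) : Prop :=
  M.Wk Γ Δ f ∧ σ = fun n => .var (n + (Δ.len - Γ.len))

variable {M}

theorem Wk.look {Γ Δ : Ctx S.Base} {f : M.env Δ ⟶ M.env Γ} (h : M.Wk Γ Δ f) :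
    ∀ {n : ℕ} {X : VTy S.Base} {g : M.env Γ ⟶ M.ty X}, M.Look Γ n X g →
      M.Look Δ (n + (Δ.len - Γ.len)) X (f ≫ g) := by
  induction h with
  | id Γ => intro n X g hg; simpa using hg
  | @comp Γ Δ Θ f g hf hg ih ih' =>
    intro n X k hk
    have h1 := hf.len_le
    have h2 := hg.len_le
    have e : n + (Θ.len - Γ.len) = n + (Δ.len - Γ.len) + (Θ.len - Δ.len) := by omega
    rw [e, Category.assoc]
    exact ih' (ih hk)
  | var Γ X =>
    intro n Y g hg
    have e : n + ((Γ.var X).len - Γ.len) = n + 1 := by simp [Ctx.len]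
    rw [e]
    exact .succ X hg
  | mod Γ τ =>
    intro n Y g hg
    have e : n + ((Γ.mod τ).len - Γ.len) = n := by simp [Ctx.len]
    rw [e, Category.assoc]
    exact .mod τ hg
  | past ht h =>
    intro n Y g hg
    rw [Category.assoc]
    exact look_past ht h hg

theorem WkSub.earlier {Γ Δ : Ctx S.Base} {σ : ℕ → Val S} {f : M.env Δ ⟶ M.env Γ}
    (h : M.WkSub Γ Δ σ f) : M.Earlier M.WkSub Γ Δ σ f := by
  obtain ⟨h, rfl⟩ := h
  intro τ Γ₀ Δ₀ hΓ hΓ₀ hΔ hΔ₀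
  obtain ⟨f₀, h₀, hf⟩ := h.minus hΓ hΓ₀ hΔ hΔ₀
  refine ⟨_, f₀, ⟨h₀, rfl⟩, fun n => ?_, hf⟩
  have h1 := h.len_le
  have h2 := h₀.len_le
  have h3 : Γ₀.len ≤ Γ.len := hΓ₀ ▸ Ctx.len_minus_le Γ τ
  have h4 : Δ₀.len ≤ Δ.len := hΔ₀ ▸ Ctx.len_minus_le Δ τ
  simp only [Val.shift, Nat.not_lt_zero, if_false]
  congr 1
  omega

theorem isSubstClass_wkSub : M.IsSubstClass (Ext M.WkSub) where
  var := .var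
  mod := .mod
  look h _ _ _ hg := by
    obtain ⟨m, hm, hg⟩ := h.look
      (Q := fun Γ V X g => ∃ m, V = .var m ∧ M.Look Γ m X g) (fun h => ⟨_, rfl, h⟩)
      (by
        rintro Γ _ X g Y ⟨m, rfl, hm⟩
        exact ⟨m + 1, by simp [Val.shift], .succ Y hm⟩)
      (by
        rintro Γ _ X g τ ⟨m, rfl, hm⟩
        exact ⟨m, rfl, .mod τ hm⟩)
      (by
        rintro Γ Δ _ f n X g ⟨h, rfl⟩ hg
        exact ⟨_, rfl, h.look hg⟩) hg
    rw [hm]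
    exact M.denotes_of_look hg
  time_le h := h.time_le fun h => h.1.time_le
  earlier h := h.earlier fun h => Earlier.mono (WkSub.earlier h) .base

theorem Denotes.weaken {Γ Δ : Ctx S.Base} {V : Val S} {X : VTy S.Base} {g : M.env Γ ⟶ M.ty X}
    {f : M.env Δ ⟶ M.env Γ} (hg : M.Denotes Γ V X g) (h : M.Wk Γ Δ f) :
    M.Denotes Δ (V.shift (Δ.len - Γ.len) 0) X (f ≫ g) := by
  obtain ⟨d, rfl⟩ := hg
  have h1 := isSubstClass_wkSub.exists_val d (.base ⟨h, rfl⟩)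
  rwa [Val.sbst_var_add] at h1

/-! # Substitution of a value -/

variable (M)

/-- The weakenings and the substitutions `[W/x]` of a value for the last variable. -/
inductive InstSub : (Γ Δ : Ctx S.Base) → (ℕ → Val S) → (M.env Δ ⟶ M.env Γ) → Prop
  | wk {Γ Δ : Ctx S.Base} {σ : ℕ → Val S} {f : M.env Δ ⟶ M.env Γ} (h : M.WkSub Γ Δ σ f) :
      InstSub Γ Δ σ f
  | inst {Γ : Ctx S.Base} {W : Val S} {X : VTy S.Base} (dW : VTyping S Γ W X) :
      InstSub (Γ.var X) Γ (instSub W 0) (lift (𝟙 (M.env Γ)) (M.val dW))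

variable {M}

/-- A positive cut of `Γ, x : X` loses `x`, so the restriction of `[W/x]` is the identity. This is
why `InstSub` has to contain weakenings. -/
theorem instSub_earlier {Γ Δ : Ctx S.Base} {σ : ℕ → Val S} {f : M.env Δ ⟶ M.env Γ}
    (h : M.InstSub Γ Δ σ f) : M.Earlier (Ext M.InstSub) Γ Δ σ f := by
  cases h with
  | wk h => exact Earlier.mono (WkSub.earlier h) fun h => .base (.wk h)
  | @inst _ W X dW =>
    intro τ Γ₀ Δ₀ hΓ hΓ₀ hΔ hΔ₀
    rcases Nat.eq_zero_or_pos τ with rfl | h0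
    · obtain rfl : Δ.var X = Γ₀ := (Ctx.minus_zero _).symm.trans hΓ₀
      obtain rfl : Δ = Δ₀ := (Ctx.minus_zero _).symm.trans hΔ₀
      exact ⟨_, _, .base (.inst dW), fun n => by simp [Val.shift_zero],
        TypeModel.toPast_zero_natural (Γ := Δ.var X) (Δ := Δ) _ _ _ _ _⟩
    · obtain rfl : Γ₀ = Δ₀ := hΓ₀.symm.trans ((Ctx.minus_var Δ X h0.ne').trans hΔ₀)
      have hl : Γ₀.len ≤ Δ.len := hΔ₀ ▸ Ctx.len_minus_le Δ τ
      refine ⟨_, _, .base (.wk ⟨.id Γ₀, rfl⟩), fun n => ?_, ?_⟩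
      · have e : n + ((Δ.var X).len - Γ₀.len) = n + (Δ.len - Γ₀.len) + 1 := by
          simp only [Ctx.len]; omega
        rw [e]
        simp [instSub, Val.shift]
      -- The value of `W` is projected away again before the cut, so the square reduces to an
      -- identity.
      · have e : lift (𝟙 (M.env Δ)) (M.val dW) ≫ M.wkVar Δ X (𝟙_ C) = 𝟙 (M.env Δ) :=
          lift_fst _ _
        rw [CategoryTheory.Functor.map_id, Category.comp_id, M.toPast_var h0.ne' hΓ hΓ₀ hΔ hΔ₀]
        exact (Category.id_comp _).symm.trans
          ((congrArg (· ≫ M.toPast hΔ hΔ₀ (𝟙_ C)) e.symm).trans (Category.assoc _ _ _))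

theorem instSub_look {Γ Δ : Ctx S.Base} {σ : ℕ → Val S} {f : M.env Δ ⟶ M.env Γ}
    (h : M.InstSub Γ Δ σ f) {n : ℕ} {X : VTy S.Base} {g : M.env Γ ⟶ M.ty X}
    (hg : M.Look Γ n X g) : M.Denotes Δ (σ n) X (f ≫ g) := by
  cases h with
  | wk h =>
    obtain ⟨h, rfl⟩ := h
    exact M.denotes_of_look (h.look hg)
  | @inst _ W Y dW =>
    cases hg with
    | zero =>
      have e : lift (𝟙 (M.env Δ)) (M.val dW) ≫ snd (M.env Δ) (M.ty X) = M.val dW :=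
        lift_snd _ _
      have e' : instSub W 0 0 = W := by simp [instSub, Val.shift_zero]
      rw [e']
      exact ⟨dW, e.symm⟩
    | @succ _ n _ g _ hg =>
      have e : lift (𝟙 (M.env Δ)) (M.val dW) ≫ M.wkVar Δ Y (𝟙_ C) = 𝟙 (M.env Δ) :=
        lift_fst _ _
      have e' : lift (𝟙 (M.env Δ)) (M.val dW) ≫ M.wkVar Δ Y (𝟙_ C) ≫ g = g :=
        (Category.assoc _ _ _).symm.trans ((congrArg (· ≫ g) e).trans (Category.id_comp g))
      obtain ⟨d, hd⟩ := M.denotes_of_look hg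
      exact ⟨d, hd.trans e'.symm⟩

theorem isSubstClass_instSub : M.IsSubstClass (Ext M.InstSub) where
  var := .var
  mod := .mod
  look h _ _ _ hg := by
    -- Each extension of the contexts weakens the substituted value once, by a variable or by a
    -- modality.
    refine h.look (Q := M.Denotes) M.denotes_of_look ?_ ?_ (fun h hg => instSub_look h hg) hg
    · intro Γ V X g Y hg
      have h1 := hg.weaken (.var Γ Y)
      have e : (Γ.var Y).len - Γ.len = 1 := by simp [Ctx.len]
      rwa [e] at h1
    · intro Γ V X g τ hg
      have h1 := hg.weaken (.mod Γ τ)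
      have e : (Γ.mod τ).len - Γ.len = 0 := by simp [Ctx.len]
      rwa [e, Val.shift_zero, Category.assoc] at h1
  time_le h := h.time_le fun h => by
    cases h with
    | wk h => exact h.1.time_le
    | inst => exact le_rfl
  earlier h := h.earlier instSub_earlier

/-- By recursion on `Γ'`: `ι` and `⟦Γ'⟧` are built one entry at a time, by whiskering with the
functor of the entry, and such a functor distributes over the threefold composite. -/
theorem ext_instSub {Γ : Ctx S.Base} {W : Val S} {X : VTy S.Base} (dW : VTyping S Γ W X) :
    ∀ Γ' : Ctx S.Base, Ext M.InstSub ((Γ.var X).append Γ') (Γ.append Γ') (instSub W Γ'.len)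
      ((M.ι Γ Γ').hom.app (𝟙_ C) ≫ (M.ctx Γ').map (lift (𝟙 (M.env Γ)) (M.val dW))
        ≫ (M.ι (Γ.var X) Γ').inv.app (𝟙_ C))
  | .nil => by
      have e : (M.ι Γ .nil).hom.app (𝟙_ C) ≫ (M.ctx .nil).map (lift (𝟙 (M.env Γ)) (M.val dW))
          ≫ (M.ι (Γ.var X) .nil).inv.app (𝟙_ C) = lift (𝟙 (M.env Γ)) (M.val dW) :=
        (Category.id_comp _).trans (Category.comp_id _)
      exact (congrArg (Ext M.InstSub (Γ.var X) Γ (instSub W 0)) e).mpr (.base (.inst dW))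
  | .var Γ' Y => by
      have h := (ext_instSub dW Γ').var Y
      rw [liftSub_instSub] at h
      have aux : ∀ {A B D E Z : C} (a : A ⟶ B) (b : B ⟶ D) (c : D ⟶ E),
          (a ≫ b ≫ c) ▷ Z = a ▷ Z ≫ b ▷ Z ≫ c ▷ Z := by intros; simp
      exact (aux _ _ _ : M.extVar _ Y = _) ▸ h
  | .mod Γ' τ => by
      have h := (ext_instSub dW Γ').mod τ
      have aux : ∀ {A B D E : C} (a : A ⟶ B) (b : B ⟶ D) (c : D ⟶ E),
          (M.past.at τ).map (a ≫ b ≫ c) = (M.past.at τ).map a ≫ (M.past.at τ).map b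
            ≫ (M.past.at τ).map c := by intros; simp
      exact (aux _ _ _ : M.extMod _ τ = _) ▸ h

end Model

end

end LambdaTau

theorem proposition4 {S : Signature.{u}} {C : Type v} [Category.{w} C]
    [CartesianMonoidalCategory C] [MonoidalClosed C] [HasProducts.{u} C] [HasProducts.{0} C]
    (M : Model S C) {Γ Γ' : Ctx S.Base} {X : VTy S.Base} {W : Val S}
    (dW : VTyping S Γ W X) :
    (∀ {V : Val S} {Y : VTy S.Base} (dV : VTyping S ((Γ.var X).append Γ') V Y),
      Nonempty (VTyping S (Γ.append Γ') (V.subst W Γ'.len) Y) ∧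
      ∀ d : VTyping S (Γ.append Γ') (V.subst W Γ'.len) Y,
        M.val d = (M.ι Γ Γ').hom.app (𝟙_ C)
          ≫ (M.ctx Γ').map (lift (𝟙 (M.env Γ)) (M.val dW))
          ≫ (M.ι (Γ.var X) Γ').inv.app (𝟙_ C)
          ≫ M.val dV) ∧
    (∀ {N : Cmp S} {Y : VTy S.Base} {τ : ℕ} (dN : CTyping S ((Γ.var X).append Γ') N Y τ),
      Nonempty (CTyping S (Γ.append Γ') (N.subst W Γ'.len) Y τ) ∧
      ∀ d : CTyping S (Γ.append Γ') (N.subst W Γ'.len) Y τ,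
        M.cmp d = (M.ι Γ Γ').hom.app (𝟙_ C)
          ≫ (M.ctx Γ').map (lift (𝟙 (M.env Γ)) (M.val dW))
          ≫ (M.ι (Γ.var X) Γ').inv.app (𝟙_ C)
          ≫ M.cmp dN) := by
  have h := Model.ext_instSub (M := M) dW Γ'
  refine ⟨fun {V Y} dV => ?_, fun {N Y τ} dN => ?_⟩
  · obtain ⟨d, hd⟩ := Model.isSubstClass_instSub.exists_val dV h
    rw [Val.subst_eq_sbst]
    refine ⟨⟨d⟩, fun d' => ?_⟩
    -- An arbitrary derivation is the constructed one, by uniqueness.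
    rw [eq_of_heq (VTyping.unique d' d).2, hd, Category.assoc]
    exact congrArg (_ ≫ ·) (Category.assoc _ _ _)
  · obtain ⟨d, hd⟩ := Model.isSubstClass_instSub.exists_cmp dN h
    rw [Cmp.subst_eq_sbst]
    refine ⟨⟨d⟩, fun d' => ?_⟩
    rw [eq_of_heq (CTyping.unique d' d).2.2, hd, Category.assoc]
    exact congrArg (_ ≫ ·) (Category.assoc _ _ _)
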